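/- Let $k$ be a field and let $a\mapsto q^a$ be a homomorphism from an additive group of exponents (containing a distinguished element $1$, e.g. $\mathbb Z$ or $\mathbb C$) to $k^\times$, with $q:=q^1\neq q^{-1}$; put $[a]=\frac{q^a-q^{-a}}{q-q^{-1}}$. Let $w_1,w_2$ be exponents and $\kappa_{LR}\in k$. Let $b_{2n}^{\phi}$ be the affine symmetric Temperley–Lieb algebra (isomorphic to the symplectic blob algebra) in the GMP parametrisation $$\delta=[2],\quad \delta_L=[w_1],\quad \delta_R=[w_2],\quad \kappa_L=[w_1+1],\quad \kappa_R=[w_2+1],\quad \kappa_{LR}\ \text{arbitrary}.$$ It has as basis the left-right symmetric, colouring composable annular Temperley–Lieb diagrams with $2n$ vertices above and $2n$ below, with no symmetric pair of contractible loops, no loop astride the $0$- or the $1$-reflection line and no pair of non-contractible loops; the product is concatenation, where a symmetric pair of contractible loops is replaced by $\delta$, a black (white) loop astride the $0$-reflection line by $\kappa_L$ ($\delta_L$), a black (white) loop astride the $1$-reflection line by $\kappa_R$ ($\delta_R$) if $n$ is even and by $\delta_R$ ($\kappa_R$) if $n$ is odd, and a pair of non-contractible loops by $\kappa_{LR}$.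 For $l>0$ let $B[l]$ (respectively $B[-l]$) be the set of basis diagrams with $2l$ propagating lines for which the region between the $0$-reflection line and the nearest propagating lines is black (respectively white), and let $B[0]$ be the set of those without propagating lines. For $d\in B[l]$ the cell module is $\mathcal S^d_{2n}(l)=(b_{2n}^\phi d+T)/T$, where $T=T_{|l|-1}$ is the ideal spanned by the diagrams with fewer than $2|l|$ propagating lines. For $l\ne0$ it has a basis of classes of diagrams $b$ with the same lower half as $d$. The inner product of $b_2$ and $b_1$ is the scalar by which $b_2^\circ b_1$ ($b_2^\circ$ is $b_2$ turned upside down) is a multiple, modulo $T$, of the diagram formed by the lower half of $d$ and its mirror image. Let $\Delta_{2n}(l)$ be the determinant of the matrix of these inner products of the basis elements. Then, for every $d\in B[l]$ and up to sign: - for $n\ge 3$: $\ \Delta_{2n}(-(n-2))=[w_1+1]\,[w_2+1]\,[w_1+w_2-n+2]$; - for $n\ge 4$: $\ \Delta_{2n}(-(n-3))=[w_2]^{n+1}\,[w_2-1]\,[w_1+1]\,[-w_1+w_2+n-2]$; - for $n\ge 4$: $\ \Delta_{2n}(n-3)=[w_1]^{n+1}\,[w_1-1]\,[w_2+1]\,[w_1-w_2+n-2]$;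 - for $n\ge 5$: $\ \Delta_{2n}(n-4)=[w_1]^{n+1}\,[w_2]^{n+1}\,[w_1-1]\,[w_2-1]\,[w_1+w_2+n-2]$. -/

import Mathlib

/-! ### Quantum numbers -/

/-- The quantum number `[a] = (q^a - q^(-a)) / (q - q⁻¹)`. Here `Λ` is the group of admissible
exponents, the character `ψ : Λ → k` is `a ↦ q^a`, and so `q = ψ 1`. For `Λ = ℤ` this gives integral
exponents over any field; `Λ = ℂ`, `ψ a = exp (h * a)` gives complex exponents. -/
noncomputable def qNum {k Λ : Type*} [Field k] [AddCommGroupWithOne Λ] (ψ : AddChar Λ k) (a : Λ) :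
    k :=
  (ψ a - ψ (-a)) / (ψ 1 - ψ (-1))

/-- The six parameters `δ, δ_L, δ_R, κ_L, κ_R, κ_LR` of the symplectic blob algebra. -/
structure BlobParams (k : Type*) where
  δ : k
  δL : k
  δR : k
  κL : k
  κR : k
  κLR : k

/-- The GMP parametrisation: `δ = [2]`, `δ_L = [w₁]`, `δ_R = [w₂]`, `κ_L = [w₁ + 1]`,
`κ_R = [w₂ + 1]`, with `κ_LR` left free. -/
noncomputable def gmpParams {k Λ : Type*} [Field k] [AddCommGroupWithOne Λ] (ψ : AddChar Λ k)
    (w₁ w₂ : Λ) (κLR : k) : BlobParams k where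
  δ := qNum ψ 2
  δL := qNum ψ w₁
  δR := qNum ψ w₂
  κL := qNum ψ (w₁ + 1)
  κR := qNum ψ (w₂ + 1)
  κLR := κLR

/-! ### Diagrams

A left-right symmetric annular Temperley-Lieb diagram is the same thing as its half on one side of
the line of symmetry. This half is a rectangle with `n` vertices on the top edge and `n` on the
bottom edge; its left edge is the `0`-reflection line and its right edge is the `1`-reflection line.
A line that meets the `0`-reflection line (`1`-reflection line) in the annulus becomes a line that
ends on the left (right) wall of the rectangle. The diagram is colouring composable when the number
of points on the left wall is even. -/

/-- The two walls of the rectangle: the `0`-reflection line (left) and the `1`-reflection line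
(right). -/
inductive Wall where
  | left
  | right
  deriving DecidableEq

/-- Where a line that starts at a vertex of one edge of the rectangle can go, if it does not return
to the same edge: to a wall, or across to the opposite edge. -/
inductive Terminus where
  | wall (s : Wall)
  | prop
  deriving DecidableEq

/-- Position from left to right: left wall, propagating lines, right wall. -/
def Terminus.rank : Terminus → ℕ
  | .wall .left => 0
  | .prop => 1
  | .wall .right => 2

/-- A half diagram: what one sees of a diagram without loops near one of its edges, after cutting
the propagating lines. `link i = inl j` means that the vertices `i` and `j` are joined, and
`link i = inr t` that the line at `i` goes to `t`. The lines do not cross. -/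
@[ext]
structure HalfDiagram (n : ℕ) where
  link : Fin n → Fin n ⊕ Terminus
  link_ne : ∀ i, link i ≠ .inl i
  link_symm : ∀ i j, link i = .inl j → link j = .inl i
  noncrossing : ∀ i j m, i < j → j < m → link i = .inl m →
    ∃ j', link j = .inl j' ∧ i < j' ∧ j' < m
  ordered : ∀ i j s t, i < j → link i = .inr s → link j = .inr t → s.rank ≤ t.rank

namespace HalfDiagram

variable {n : ℕ}

/-- The number of vertices whose line goes to `t`. -/
def count (x : HalfDiagram n) (t : Terminus) : ℕ :=
  (Finset.univ.filter fun i => x.link i = .inr t).card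

/-- The number of cut propagating lines to the left of the vertex `i`. -/
def propRank (x : HalfDiagram n) (i : Fin n) : ℕ :=
  (Finset.univ.filter fun j => x.link j = .inr .prop ∧ j < i).card

/-- The number of lines to the wall `s` which start nearer to that wall than the vertex `i`. -/
def nearer (x : HalfDiagram n) : Wall → Fin n → ℕ
  | .left, i => (Finset.univ.filter fun j => x.link j = .inr (.wall .left) ∧ j < i).card
  | .right, i => (Finset.univ.filter fun j => x.link j = .inr (.wall .right) ∧ i < j).card

/-- `-p` or `p`, where `p` is the number of propagating lines; the sign is negative if the region
between the left wall and the first propagating line is white (the top left corner is white, and the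
colour changes across each line that ends on the left wall) and positive if this region is black. -/
def label (x : HalfDiagram n) : ℤ :=
  if Even (x.count (.wall .left)) then -(x.count .prop : ℤ) else (x.count .prop : ℤ)

end HalfDiagram

/-- The diagrams with `n` vertices above and `n` below, without the features that are straightened:
no closed loop, no line from a wall to the same wall, and at most one line from the left wall to
the right wall. Such a diagram is recorded by its upper and its lower half; as lines do not cross,
the `m`-th cut propagating line above is the `m`-th one below. The number of points on the left wall
is even. If there are propagating lines, then no line joins the two walls and this is the condition
`parity`. If there are none, then this says that a line from the left wall to the right wall is
present exactly when the vertices account for an odd number of points on the left wall. -/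
@[ext]
structure Diagram (n : ℕ) where
  top : HalfDiagram n
  bot : HalfDiagram n
  prop_eq : top.count .prop = bot.count .prop
  parity : top.count .prop ≠ 0 →
    (Even (top.count (.wall .left)) ↔ Even (bot.count (.wall .left)))

namespace Diagram

variable {n : ℕ}

/-- The diagram turned upside down. -/
def flip (d : Diagram n) : Diagram n where
  top := d.bot
  bot := d.top
  prop_eq := d.prop_eq.symm
  parity h := (d.parity (by rw [d.prop_eq]; exact h)).symm

/-- The diagram with lower half that of `d`, and with upper half the lower half of `d` turned upside
down. -/
def doubleBot (d : Diagram n) : Diagram n where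
  top := d.bot
  bot := d.bot
  prop_eq := rfl
  parity _ := Iff.rfl

/-- The `l` for which the diagram belongs to `B[l]`: half of the number of propagating lines in the
annulus, with sign `+` if the inner region is black and `-` if it is white. -/
def label (d : Diagram n) : ℤ := d.top.label

/-- Where the line at a vertex goes; `inl i` is the vertex `i` above, `inr i` the vertex `i` below. -/
def linkAt (d : Diagram n) : Fin n ⊕ Fin n → Fin n ⊕ Terminus
  | .inl i => d.top.link i
  | .inr i => d.bot.link i

/-- Two vertices are adjacent if a line of the diagram joins them. -/
def lineAdj (d : Diagram n) : Fin n ⊕ Fin n → Fin n ⊕ Fin n → Prop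
  | .inl i, .inl j => d.top.link i = .inl j
  | .inr i, .inr j => d.bot.link i = .inl j
  | .inl i, .inr j =>
    d.top.link i = .inr .prop ∧ d.bot.link j = .inr .prop ∧ d.top.propRank i = d.bot.propRank j
  | .inr j, .inl i =>
    d.top.link i = .inr .prop ∧ d.bot.link j = .inr .prop ∧ d.top.propRank i = d.bot.propRank j

theorem lineAdj_symm (d : Diagram n) (u v : Fin n ⊕ Fin n) (h : d.lineAdj u v) :
    d.lineAdj v u := by
  rcases u with i | i <;> rcases v with j | j
  · exact d.top.link_symm i j h
  · exact h
  · exact h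
  · exact d.bot.link_symm i j h

/-- The number (zero or one) of lines from the left wall to the right wall. -/
def crossLines (d : Diagram n) : ℕ :=
  (d.top.count (.wall .left) + d.bot.count (.wall .left)) % 2

/-- The number of points on the wall `s`. -/
def wallCount (d : Diagram n) (s : Wall) : ℕ :=
  d.top.count (.wall s) + d.bot.count (.wall s) + d.crossLines

/-- If the line at a vertex goes to the wall `s`: the number of points on this wall above the end of
the line. -/
def wallPos (d : Diagram n) (s : Wall) : Fin n ⊕ Fin n → ℕ
  | .inl i => d.top.nearer s i
  | .inr i => d.wallCount s - 1 - d.bot.nearer s i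

/-! ### Concatenation

`d₁` is put on top of `d₂`. The vertices of the picture are the pairs `(a, i)` with `a = 0` for the
upper edge of `d₁`, `a = 1` for the common edge and `a = 2` for the lower edge of `d₂`. -/

/-- The vertices of the upper diagram. -/
def placeUpper : Fin n ⊕ Fin n → Fin 3 × Fin n
  | .inl i => (0, i)
  | .inr i => (1, i)

/-- The vertices of the lower diagram. -/
def placeLower : Fin n ⊕ Fin n → Fin 3 × Fin n
  | .inl i => (1, i)
  | .inr i => (2, i)

/-- The concatenated picture, as a graph. -/
def glue (d₁ d₂ : Diagram n) : SimpleGraph (Fin 3 × Fin n) :=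
  SimpleGraph.fromRel fun a b =>
    (∃ u v, d₁.lineAdj u v ∧ placeUpper u = a ∧ placeUpper v = b) ∨
    (∃ u v, d₂.lineAdj u v ∧ placeLower u = a ∧ placeLower v = b)

/-- For a line of the concatenated picture (a component `c` of the graph): the positions, counted
from the top and starting from zero, of its end points on the wall `s`. -/
def wallEnds (d₁ d₂ : Diagram n) (c : (glue d₁ d₂).ConnectedComponent) (s : Wall) : Set ℕ :=
  {p | (∃ u, placeUpper u ∈ c.supp ∧ d₁.linkAt u = .inr (.wall s) ∧ p = d₁.wallPos s u) ∨
       (∃ u, placeLower u ∈ c.supp ∧ d₂.linkAt u = .inr (.wall s) ∧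
          p = d₁.wallCount s + d₂.wallPos s u)}

/-- A line of the concatenated picture that does not reach its upper or lower edge. -/
def IsInner (d₁ d₂ : Diagram n) (c : (glue d₁ d₂).ConnectedComponent) : Prop :=
  ∀ a ∈ c.supp, a.1 = 1

open Classical in
/-- The scalar by which an inner line is replaced. A closed loop gives `δ`. A line from the left wall
to the left wall is half of a loop astride the `0`-reflection line; the inside of this loop is the
region below the upper end of the line, and this is black if the number of wall points above that
end is even, and white if it is odd: black loops give `κ_L` and white loops give `δ_L`. On the right
wall, the topmost region is white or black according to the parity of `n`; by the same convention for
the `1`-reflection line the loop gives `κ_R` if the number of wall points above the upper end is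
even, and `δ_R` if it is odd. A line from the left wall to the right wall is taken into account in
`coeff`. -/
noncomputable def lineWeight {k : Type*} [Field k] (P : BlobParams k) (d₁ d₂ : Diagram n)
    (c : (glue d₁ d₂).ConnectedComponent) : k :=
  if IsInner d₁ d₂ c then
    if wallEnds d₁ d₂ c .left = ∅ then
      if wallEnds d₁ d₂ c .right = ∅ then P.δ
      else if Even (sInf (wallEnds d₁ d₂ c .right)) then P.κR else P.δR
    else
      if wallEnds d₁ d₂ c .right = ∅ then
        if Even (sInf (wallEnds d₁ d₂ c .left)) then P.κL else P.δL
      else 1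
  else 1

/-- The number of lines from the left wall to the right wall in the concatenated picture, each of
which is half of a non-contractible loop. -/
noncomputable def crossCount (d₁ d₂ : Diagram n) : ℕ :=
  d₁.crossLines + d₂.crossLines +
    {c : (glue d₁ d₂).ConnectedComponent | IsInner d₁ d₂ c ∧
      (wallEnds d₁ d₂ c .left).Nonempty ∧ (wallEnds d₁ d₂ c .right).Nonempty}.ncard

/-- The scalar that arises when the concatenation of `d₁` and `d₂` is straightened; each pair of
non-contractible loops gives `κ_LR`. -/
noncomputable def coeff {k : Type*} [Field k] (P : BlobParams k) (d₁ d₂ : Diagram n) : k :=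
  P.κLR ^ (crossCount d₁ d₂ / 2) * ∏ᶠ c, lineWeight P d₁ d₂ c

/-- `x` is the half diagram that one sees at the edge `a` of the concatenated picture, where `b` is
the opposite edge. -/
def IsHalfOfGlue (d₁ d₂ : Diagram n) (a b : Fin 3) (x : HalfDiagram n) : Prop :=
  ∀ i,
    (∀ j, x.link i = .inl j ↔ j ≠ i ∧ (glue d₁ d₂).Reachable (a, i) (a, j)) ∧
    (x.link i = .inr .prop ↔ ∃ j, (glue d₁ d₂).Reachable (a, i) (b, j)) ∧
    ∀ s, x.link i = .inr (.wall s) ↔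
      (wallEnds d₁ d₂ ((glue d₁ d₂).connectedComponentMk (a, i)) s).Nonempty

/-- `d₃` is what remains of the concatenation of `d₁` and `d₂` when it is straightened. -/
def IsComposite (d₁ d₂ d₃ : Diagram n) : Prop :=
  IsHalfOfGlue d₁ d₂ 0 2 d₃.top ∧ IsHalfOfGlue d₁ d₂ 2 0 d₃.bot

end Diagram

/-! ### The algebra, its cell modules and their Gram determinants -/

/-- The underlying space of the symplectic blob algebra (affine symmetric Temperley-Lieb algebra):
the `k`-space with basis the diagrams. -/
abbrev BlobSpace (k : Type*) [Field k] (n : ℕ) : Type _ := Diagram n →₀ k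

namespace BlobSpace

variable {k : Type*} [Field k] {n : ℕ}

open Classical in
/-- The product of two diagrams. The diagram that remains after straightening always exists, and it
is unique. -/
noncomputable def mulDiagram (P : BlobParams k) (d₁ d₂ : Diagram n) : BlobSpace k n :=
  if h : ∃ d₃, Diagram.IsComposite d₁ d₂ d₃ then
    Finsupp.single h.choose (Diagram.coeff P d₁ d₂)
  else 0

/-- The multiplication of the symplectic blob algebra with parameters `P`. -/
noncomputable def mul (P : BlobParams k) : BlobSpace k n →ₗ[k] BlobSpace k n →ₗ[k] BlobSpace k n :=
  Finsupp.linearCombination k fun d₁ => Finsupp.linearCombination k fun d₂ => mulDiagram P d₁ d₂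

/-- The ideal spanned by the diagrams in all `B[a]` with `|a| < |l|`, written `T_{|l| - 1}`. -/
noncomputable def lowerIdeal (k : Type*) [Field k] (n : ℕ) (l : ℤ) : Submodule k (BlobSpace k n) :=
  Submodule.span k {x | ∃ c : Diagram n, |c.label| < |l| ∧ x = Finsupp.single c 1}

/-- The cell module `(b d + T) / T`, where `b` is the algebra, `d ∈ B[l]` and `T = T_{|l| - 1}`. -/
noncomputable def cellModule (P : BlobParams k) (d : Diagram n) :
    Submodule k (BlobSpace k n ⧸ lowerIdeal k n d.label) :=
  (LinearMap.range ((mul P).flip (Finsupp.single d 1))).map (lowerIdeal k n d.label).mkQ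

/-- The set `s` of diagrams gives a basis of the cell module generated by `d`. -/
def IsMonomialBasis (P : BlobParams k) (d : Diagram n) (s : Finset (Diagram n)) : Prop :=
  LinearIndependent k
      (fun b : s => (lowerIdeal k n d.label).mkQ (Finsupp.single (b : Diagram n) 1)) ∧
    Submodule.span k
      (Set.range fun b : s => (lowerIdeal k n d.label).mkQ (Finsupp.single (b : Diagram n) 1)) =
    cellModule P d

/-- The inner product of two elements `b₁`, `b₂` of a monomial basis: `b₂` turned upside down, times
`b₁`, is this scalar times the diagram formed by the lower half of `d` and its mirror image, or has
fewer propagating lines. -/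
noncomputable def gram (P : BlobParams k) (d b₂ b₁ : Diagram n) : k :=
  mulDiagram P b₂.flip b₁ d.doubleBot

open Classical in
/-- The determinant of the matrix of inner products of the elements of `s`. -/
noncomputable def gramDet (P : BlobParams k) (d : Diagram n) (s : Finset (Diagram n)) : k :=
  Matrix.det (Matrix.of fun b₂ b₁ : s => gram P d b₂ b₁)

/-- Up to sign, the Gram determinant of the cell module with label `l` is `D`: there are diagrams
in `B[l]`, and for each of them the cell module that it generates has a monomial basis, and the Gram
determinant in every monomial basis is `D` or `-D`. -/
def IsGramDetUpToSign (P : BlobParams k) (n : ℕ) (l : ℤ) (D : k) : Prop :=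
  (∃ d : Diagram n, d.label = l) ∧
    ∀ d : Diagram n, d.label = l →
      (∃ s, IsMonomialBasis P d s) ∧
        ∀ s, IsMonomialBasis P d s → gramDet P d s = D ∨ gramDet P d s = -D

end BlobSpace

/-!
The diagrams of a cell module with `p ≥ 1` propagating lines differ in their upper halves only,
which have `p` lines across and the right colour. In the four cases `n = p + 2 + a + b` with
`a, b ∈ {0, 1}`: one line to the left wall is forced if `a = 1`, one to the right wall if `b = 1`,
and one pair of vertices is left. This pair goes to the left wall, or to the right wall, or it is an
arc between neighbours, which gives the `n + 1` half diagrams `cellRow` (`exists_eq_cellRow`).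

When two of them are put together, either a propagating line is lost, or the diagram that remains is
the expected one and the scalar is read off from the lines that meet the common edge
(`cellRow_pairsTo_or_blocked`). The structure `Pairing` collects the data from which the product of
two diagrams can be computed (`mulDiagram_of_pairsTo`), and `Blocked` is a certificate that
propagating lines are lost (`not_isComposite_of_blocked`). The outcome is that the Gram matrix is
`δ_L ^ a * δ_R ^ b` times the matrix `cellGram`, which is the Gram matrix of the Temperley-Lieb
algebra with a modified first and last row and column, and it is tridiagonal but for an entry
`δ_L` (if `a = 1`) or `δ_R` (if `b = 1`) near two of the corners. Subtracting `δ_L` times the second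
row and column from the first ones removes the entries `δ_L`, and as `[w][2] = [w + 1] + [w - 1]` it has
the effect of replacing `w₁` by `-w₁`; likewise for the right end. What is left is a determinant
with the exponents `± w₁`, `± w₂` in its corners, which the three-term recurrence for tridiagonal
determinants and the addition formula `qNum_add` evaluate (`cornerDet_blob`,
`cornerDet_cellGram`).

It remains to compare with the cell module as a left ideal modulo lower diagrams. Since the product
of two diagrams is a multiple of a diagram, a cell module has exactly one monomial basis, the set
`cellSupport` of the diagrams that occur in a product with the generator `d`
(`isMonomialBasis_iff`). If `d` has a nonzero inner product with some diagram, then this set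
consists of all diagrams with the lower half of `d`. The parameters may be such that there is no
such diagram, and the cell module may then be smaller; but `d` lies in it and gives a zero column of
its Gram matrix as well as of the full one, so that both determinants vanish.
-/

/-! ### Half diagrams and the concatenated picture -/

namespace HalfDiagram

variable {n : ℕ}

theorem propRank_lt_count (x : HalfDiagram n) {i : Fin n} (hi : x.link i = .inr .prop) :
    x.propRank i < x.count .prop := by
  refine Finset.card_lt_card (Finset.ssubset_iff_of_subset ?_ |>.2 ⟨i, ?_, ?_⟩)
  · intro j; simp +contextual
  · simpa using hi
  · simp

theorem propRank_strictMono (x : HalfDiagram n) {i j : Fin n} (hi : x.link i = .inr .prop)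
    (hij : i < j) : x.propRank i < x.propRank j := by
  refine Finset.card_lt_card (Finset.ssubset_iff_of_subset ?_ |>.2 ⟨i, ?_, ?_⟩)
  · intro m; simp only [Finset.mem_filter, Finset.mem_univ, true_and]
    exact fun h => ⟨h.1, h.2.trans hij⟩
  · simpa using ⟨hi, hij⟩
  · simp

theorem propRank_inj (x : HalfDiagram n) {i j : Fin n} (hi : x.link i = .inr .prop)
    (hj : x.link j = .inr .prop) (h : x.propRank i = x.propRank j) : i = j := by
  rcases lt_trichotomy i j with hij | hij | hij
  · exact absurd h (x.propRank_strictMono hi hij).ne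
  · exact hij
  · exact absurd h (x.propRank_strictMono hj hij).ne'

theorem exists_propRank_eq (x : HalfDiagram n) {m : ℕ} (hm : m < x.count .prop) :
    ∃ i, x.link i = .inr .prop ∧ x.propRank i = m := by
  have himg : (Finset.univ.filter fun i => x.link i = .inr .prop).image x.propRank =
      Finset.range (x.count .prop) := by
    refine Finset.eq_of_subset_of_card_le ?_ ?_
    · intro m hm
      obtain ⟨i, hi, rfl⟩ := Finset.mem_image.1 hm
      exact Finset.mem_range.2 (x.propRank_lt_count (by simpa using hi))
    · rw [Finset.card_range, Finset.card_image_of_injOn]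
      · exact le_rfl
      · intro i hi j hj h
        exact x.propRank_inj (by simpa using hi) (by simpa using hj) h
  obtain ⟨i, hi, h⟩ := Finset.mem_image.1 (himg ▸ Finset.mem_range.2 hm)
  exact ⟨i, by simpa using hi, h⟩

theorem nearer_lt_count (x : HalfDiagram n) {s : Wall} {i : Fin n}
    (hi : x.link i = .inr (.wall s)) : x.nearer s i < x.count (.wall s) := by
  cases s
  all_goals
    refine Finset.card_lt_card (Finset.ssubset_iff_of_subset ?_ |>.2 ⟨i, ?_, ?_⟩)
    · intro j; simp +contextual
    · simpa using hi
    · simp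

/-- The vertices that lie on arcs come in pairs. -/
theorem even_card_isLeft (x : HalfDiagram n) :
    Even (Finset.univ.filter fun i => (x.link i).isLeft).card := by
  rw [← ZMod.natCast_eq_zero_iff_even, Finset.card_eq_sum_ones, Nat.cast_sum]
  refine Finset.sum_involution (fun i _ => Sum.elim id (fun _ => i) (x.link i)) ?_ ?_ ?_ ?_
  · intro i _; simp; decide
  · intro i hi _ h
    obtain ⟨j, hj⟩ := Sum.isLeft_iff.1 (Finset.mem_filter.1 hi).2
    simp only [hj, Sum.elim_inl, id] at h
    exact x.link_ne i (h ▸ hj)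
  · intro i hi
    obtain ⟨j, hj⟩ := Sum.isLeft_iff.1 (Finset.mem_filter.1 hi).2
    simp [hj, x.link_symm i j hj]
  · intro i hi
    obtain ⟨j, hj⟩ := Sum.isLeft_iff.1 (Finset.mem_filter.1 hi).2
    simp [hj, x.link_symm i j hj]

/-- The vertices are those on arcs and those which lead to a wall or across. -/
theorem card_isLeft_add_counts (x : HalfDiagram n) :
    (Finset.univ.filter fun i => (x.link i).isLeft).card + x.count (.wall .left) + x.count .prop +
      x.count (.wall .right) = n := by
  have h (i : Fin n) : (1 : ℕ) = (if (x.link i).isLeft then 1 else 0) +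
      (if x.link i = .inr (.wall .left) then 1 else 0) + (if x.link i = .inr .prop then 1 else 0) +
      (if x.link i = .inr (.wall .right) then 1 else 0) := by
    rcases x.link i with j | (_ | _) | _ <;> simp
  have := Finset.sum_congr (rfl : (Finset.univ : Finset (Fin n)) = _) fun i _ => h i
  simp only [Finset.sum_add_distrib, ← Finset.card_filter, Finset.sum_const, Finset.card_univ,
    Fintype.card_fin, smul_eq_mul, mul_one] at this
  exact this.symm

/-- The number of vertices to the left of `i` that are not on arcs. -/
def freeBefore (x : HalfDiagram n) (i : Fin n) : ℕ :=
  (Finset.univ.filter fun j => (x.link j).isRight ∧ j < i).card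

theorem rank_le_of_lt (x : HalfDiagram n) {i j : Fin n} {s t : Terminus} (hij : i < j)
    (hi : x.link i = .inr s) (hj : x.link j = .inr t) : s.rank ≤ t.rank :=
  x.ordered i j s t hij hi hj

theorem freeBefore_lt_of_left (x : HalfDiagram n) {i : Fin n}
    (hi : x.link i = .inr (.wall .left)) : x.freeBefore i < x.count (.wall .left) := by
  refine Finset.card_lt_card (Finset.ssubset_iff_of_subset ?_ |>.2 ⟨i, ?_, ?_⟩)
  · intro j
    simp only [Finset.mem_filter, Finset.mem_univ, true_and, and_imp]
    intro hj hji
    obtain ⟨s, hs⟩ := Sum.isRight_iff.1 hj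
    have := x.rank_le_of_lt hji hs hi
    rcases s with (_ | _) | _ <;> simp_all [Terminus.rank]
  · simpa using hi
  · simp

theorem count_left_le_freeBefore (x : HalfDiagram n) {i : Fin n} {s : Terminus}
    (hi : x.link i = .inr s) (hs : s ≠ .wall .left) :
    x.count (.wall .left) ≤ x.freeBefore i := by
  refine Finset.card_le_card fun j => ?_
  simp only [Finset.mem_filter, Finset.mem_univ, true_and]
  intro hj
  refine ⟨by simp [hj], ?_⟩
  rcases lt_trichotomy j i with h | h | h
  · exact h
  · subst h; simp_all
  · have := x.rank_le_of_lt h hi hj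
    rcases s with (_ | _) | _ <;> simp_all [Terminus.rank]

theorem count_left_add_count_prop (x : HalfDiagram n) :
    x.count (.wall .left) + x.count .prop = (Finset.univ.filter fun i =>
      x.link i = .inr (.wall .left) ∨ x.link i = .inr .prop).card := by
  rw [Finset.filter_or, Finset.card_union_of_disjoint]
  · rfl
  · exact Finset.disjoint_filter.2 fun i _ h h' => by simp [h] at h'

theorem freeBefore_lt_of_prop (x : HalfDiagram n) {i : Fin n} (hi : x.link i = .inr .prop) :
    x.freeBefore i < x.count (.wall .left) + x.count .prop := by
  rw [count_left_add_count_prop]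
  refine Finset.card_lt_card (Finset.ssubset_iff_of_subset ?_ |>.2 ⟨i, ?_, ?_⟩)
  · intro j
    simp only [Finset.mem_filter, Finset.mem_univ, true_and, and_imp]
    intro hj hji
    obtain ⟨s, hs⟩ := Sum.isRight_iff.1 hj
    have := x.rank_le_of_lt hji hs hi
    rcases s with (_ | _) | _ <;> simp_all [Terminus.rank]
  · simp [hi]
  · simp

theorem le_freeBefore_of_right (x : HalfDiagram n) {i : Fin n}
    (hi : x.link i = .inr (.wall .right)) :
    x.count (.wall .left) + x.count .prop ≤ x.freeBefore i := by
  rw [count_left_add_count_prop]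
  refine Finset.card_le_card fun j => ?_
  simp only [Finset.mem_filter, Finset.mem_univ, true_and]
  intro hj
  refine ⟨by rcases hj with hj | hj <;> simp [hj], ?_⟩
  rcases lt_trichotomy j i with h | h | h
  · exact h
  · subst h; simp_all
  · rcases hj with hj | hj
    all_goals
      have := x.rank_le_of_lt h hi hj
      simp [Terminus.rank] at this

/-- The destination of the `m`-th vertex off the arcs if `ℓ` lines go to the left wall and `p` lines
propagate. -/
def letter (ℓ p m : ℕ) : Terminus :=
  if m < ℓ then .wall .left else if m < ℓ + p then .prop else .wall .right

/-- As lines do not cross, the destinations of the vertices off the arcs are determined by the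
numbers of lines to the walls. -/
theorem link_eq_letter (x : HalfDiagram n) {i : Fin n} (hi : (x.link i).isRight) :
    x.link i = .inr (letter (x.count (.wall .left)) (x.count .prop) (x.freeBefore i)) := by
  obtain ⟨s, hs⟩ := Sum.isRight_iff.1 hi
  rw [hs, letter]
  rcases s with (_ | _) | _
  · rw [if_pos (x.freeBefore_lt_of_left hs)]
  · have := x.le_freeBefore_of_right hs
    rw [if_neg (by omega), if_neg (by omega)]
  · rw [if_neg (x.count_left_le_freeBefore hs (by simp)).not_gt,
      if_pos (x.freeBefore_lt_of_prop hs)]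

end HalfDiagram

namespace Diagram

variable {n : ℕ}

theorem crossLines_eq_zero (d : Diagram n) (h : d.top.count .prop ≠ 0) : d.crossLines = 0 := by
  have := d.parity h
  rw [crossLines]
  grind

/-- If lines propagate, then the number of points on each wall is even. -/
theorem even_wallCount (d : Diagram n) (h : d.top.count .prop ≠ 0) (s : Wall) :
    Even (d.wallCount s) := by
  have h1 := d.parity h
  have h2 := d.prop_eq
  have h3 := d.top.even_card_isLeft
  have h4 := d.bot.even_card_isLeft
  have h5 := d.top.card_isLeft_add_counts
  have h6 := d.bot.card_isLeft_add_counts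
  rw [wallCount, d.crossLines_eq_zero h]
  cases s <;> grind

/-- A quantity that is constant along the lines of both diagrams is constant on the lines of the
concatenated picture. -/
theorem eq_of_reachable {d₁ d₂ : Diagram n} {α : Type*} (f : Fin 3 × Fin n → α)
    (h₁ : ∀ u v, d₁.lineAdj u v → f (placeUpper u) = f (placeUpper v))
    (h₂ : ∀ u v, d₂.lineAdj u v → f (placeLower u) = f (placeLower v))
    {x y : Fin 3 × Fin n} (h : (glue d₁ d₂).Reachable x y) : f x = f y := by
  obtain ⟨w⟩ := h
  induction w with
  | nil => rfl
  | cons hadj _ ih =>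
    refine Eq.trans ?_ ih
    obtain ⟨-, (⟨u, v, h, rfl, rfl⟩ | ⟨u, v, h, rfl, rfl⟩) |
      (⟨u, v, h, rfl, rfl⟩ | ⟨u, v, h, rfl, rfl⟩)⟩ := hadj
    · exact h₁ u v h
    · exact h₂ u v h
    · exact (h₁ u v h).symm
    · exact (h₂ u v h).symm

/-- A set of vertices closed under the lines of both diagrams is closed under the lines of the
concatenated picture. -/
theorem mem_of_reachable {d₁ d₂ : Diagram n} (S : Set (Fin 3 × Fin n))
    (h₁ : ∀ u v, d₁.lineAdj u v → placeUpper u ∈ S → placeUpper v ∈ S)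
    (h₂ : ∀ u v, d₂.lineAdj u v → placeLower u ∈ S → placeLower v ∈ S)
    {x y : Fin 3 × Fin n} (h : (glue d₁ d₂).Reachable x y) (hx : x ∈ S) : y ∈ S := by
  have := eq_of_reachable (d₁ := d₁) (d₂ := d₂) (fun x => x ∈ S)
    (fun u v h => propext ⟨h₁ u v h, h₁ v u (d₁.lineAdj_symm _ _ h)⟩)
    (fun u v h => propext ⟨h₂ u v h, h₂ v u (d₂.lineAdj_symm _ _ h)⟩) h
  exact this ▸ hx

theorem reachable_upper {d₁ d₂ : Diagram n} {u v : Fin n ⊕ Fin n} (h : d₁.lineAdj u v) :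
    (glue d₁ d₂).Reachable (placeUpper u) (placeUpper v) := by
  by_cases huv : placeUpper u = placeUpper v
  · rw [huv]
  · exact SimpleGraph.Adj.reachable ⟨huv, .inl (.inl ⟨u, v, h, rfl, rfl⟩)⟩

theorem reachable_lower {d₁ d₂ : Diagram n} {u v : Fin n ⊕ Fin n} (h : d₂.lineAdj u v) :
    (glue d₁ d₂).Reachable (placeLower u) (placeLower v) := by
  by_cases huv : placeLower u = placeLower v
  · rw [huv]
  · exact SimpleGraph.Adj.reachable ⟨huv, .inl (.inr ⟨u, v, h, rfl, rfl⟩)⟩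

theorem IsHalfOfGlue.unique {d₁ d₂ : Diagram n} {a b : Fin 3} {x y : HalfDiagram n}
    (hx : IsHalfOfGlue d₁ d₂ a b x) (hy : IsHalfOfGlue d₁ d₂ a b y) : x = y := by
  ext1
  funext i
  obtain ⟨x1, x2, x3⟩ := hx i
  obtain ⟨y1, y2, y3⟩ := hy i
  rcases h : x.link i with j | s | _
  · exact ((y1 j).2 ((x1 j).1 h)).symm
  · exact ((y3 s).2 ((x3 s).1 h)).symm
  · exact (y2.2 (x2.1 h)).symm

theorem IsComposite.unique {d₁ d₂ d₃ d₃' : Diagram n} (h : IsComposite d₁ d₂ d₃)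
    (h' : IsComposite d₁ d₂ d₃') : d₃ = d₃' :=
  Diagram.ext (h.1.unique h'.1) (h.2.unique h'.2)

end Diagram

namespace BlobSpace

variable {k : Type*} [Field k] {n : ℕ}

theorem mulDiagram_of_isComposite (P : BlobParams k) {d₁ d₂ d₃ : Diagram n}
    (h : Diagram.IsComposite d₁ d₂ d₃) :
    mulDiagram P d₁ d₂ = Finsupp.single d₃ (Diagram.coeff P d₁ d₂) := by
  have hex : ∃ d₃, Diagram.IsComposite d₁ d₂ d₃ := ⟨d₃, h⟩
  rw [mulDiagram, dif_pos hex, hex.choose_spec.unique h]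

theorem mulDiagram_apply_of_not_isComposite (P : BlobParams k) {d₁ d₂ d₃ : Diagram n}
    (h : ¬ Diagram.IsComposite d₁ d₂ d₃) : mulDiagram P d₁ d₂ d₃ = 0 := by
  classical
  rw [mulDiagram]
  split_ifs with hex
  · rw [Finsupp.single_apply, if_neg]
    intro he
    exact h (he ▸ hex.choose_spec)
  · rfl

end BlobSpace

/-! ### Certificates for the concatenation of half diagrams -/

/-- The scalar for a line from the wall `s` to itself with `m` wall points above its upper end, up
to an even number. -/
def BlobParams.wallScalar {k : Type*} (P : BlobParams k) : Wall → ℕ → k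
  | .left, m => if Even m then P.κL else P.δL
  | .right, m => if Even m then P.κR else P.δR

theorem BlobParams.wallScalar_congr {k : Type*} (P : BlobParams k) (s : Wall) {m m' : ℕ}
    (h : Even m ↔ Even m') : P.wallScalar s m = P.wallScalar s m' := by
  cases s <;> simp [wallScalar, h]

theorem BlobParams.wallScalar_of_odd_left {k : Type*} (P : BlobParams k) {m : ℕ} (h : m % 2 = 1) :
    P.wallScalar .left m = P.δL :=
  if_neg (by rw [Nat.even_iff]; omega)

theorem BlobParams.wallScalar_of_even_left {k : Type*} (P : BlobParams k) {m : ℕ} (h : m % 2 = 0) :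
    P.wallScalar .left m = P.κL :=
  if_pos (Nat.even_iff.2 h)

theorem BlobParams.wallScalar_of_odd_right {k : Type*} (P : BlobParams k) {m : ℕ} (h : m % 2 = 1) :
    P.wallScalar .right m = P.δR :=
  if_neg (by rw [Nat.even_iff]; omega)

theorem BlobParams.wallScalar_of_even_right {k : Type*} (P : BlobParams k) {m : ℕ} (h : m % 2 = 0) :
    P.wallScalar .right m = P.κR :=
  if_pos (Nat.even_iff.2 h)

namespace HalfDiagram

variable {k : Type*} [Field k] {n : ℕ}

/-- Whether the vertices `i` of `u` and `j` of `t`, both with destination `τ`, are placed in such a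
way that a line of the concatenation may end at both: propagating lines must have the same position,
and for lines to a wall the positions must agree modulo two. -/
def Matches (u t : HalfDiagram n) (i j : Fin n) : Terminus → Prop
  | .prop => u.propRank i = t.propRank j
  | .wall s => Even (u.nearer s i) ↔ Even (t.nearer s j)

/-- The scalar for a line that runs through the vertex `i` of `u` to the destination `τ` above, and
to the same destination below. -/
def throughScalar (P : BlobParams k) (u : HalfDiagram n) (i : Fin n) : Terminus → k
  | .prop => 1
  | .wall s => P.wallScalar s (u.nearer s i + 1)

theorem Matches.symm {u t : HalfDiagram n} {i j : Fin n} {τ : Terminus} (h : Matches u t i j τ) :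
    Matches t u j i τ := by
  cases τ
  · exact Iff.symm h
  · exact Eq.symm h

theorem Matches.throughScalar_eq (P : BlobParams k) {u t : HalfDiagram n} {i j : Fin n}
    {τ : Terminus} (h : Matches u t i j τ) : throughScalar P u i τ = throughScalar P t j τ := by
  cases τ
  · refine P.wallScalar_congr _ ?_
    rw [Nat.even_add_one, Nat.even_add_one]
    exact not_congr h
  · rfl

/-- The vertices in `C` are those on the common edge which belong to one line of the picture with
`u` above and `t` below the edge, and this line contributes the given scalar. The line is a closed
loop, or it runs through the edge, or it returns to a wall above or below the edge. -/
inductive LineScalar (P : BlobParams k) (u t : HalfDiagram n) (C : Set (Fin n)) : k → Prop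
  | loop : (∀ m ∈ C, ¬ (u.link m).isRight) → (∀ m ∈ C, ¬ (t.link m).isRight) →
      LineScalar P u t C P.δ
  | through (τ : Terminus) (i j : Fin n) : i ∈ C → j ∈ C → u.link i = .inr τ → t.link j = .inr τ →
      (∀ m ∈ C, (u.link m).isRight → m = i) → (∀ m ∈ C, (t.link m).isRight → m = j) →
      Matches u t i j τ → LineScalar P u t C (throughScalar P u i τ)
  | upper (s : Wall) (i j : Fin n) : i ∈ C → j ∈ C →
      u.link i = .inr (.wall s) → u.link j = .inr (.wall s) →
      (∀ m ∈ C, (u.link m).isRight → m = i ∨ m = j) → (∀ m ∈ C, ¬ (t.link m).isRight) →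
      u.nearer s j = u.nearer s i + 1 → LineScalar P u t C (P.wallScalar s (u.nearer s i))
  | lower (s : Wall) (i j : Fin n) : i ∈ C → j ∈ C →
      t.link i = .inr (.wall s) → t.link j = .inr (.wall s) →
      (∀ m ∈ C, (t.link m).isRight → m = i ∨ m = j) → (∀ m ∈ C, ¬ (u.link m).isRight) →
      t.nearer s j = t.nearer s i + 1 → LineScalar P u t C (P.wallScalar s (t.nearer s i))

theorem LineScalar.symm {P : BlobParams k} {u t : HalfDiagram n} {C : Set (Fin n)} {w : k}
    (h : LineScalar P u t C w) : LineScalar P t u C w := by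
  cases h with
  | loop h1 h2 => exact .loop h2 h1
  | through τ i j h1 h2 h3 h4 h5 h6 h7 =>
    rw [h7.throughScalar_eq P]
    exact .through τ j i h2 h1 h4 h3 h6 h5 h7.symm
  | upper s i j h1 h2 h3 h4 h5 h6 h7 => exact .lower s i j h1 h2 h3 h4 h5 h6 h7
  | lower s i j h1 h2 h3 h4 h5 h6 h7 => exact .upper s i j h1 h2 h3 h4 h5 h6 h7

/-- A description of the picture with `u` above and `t` below the common edge in which all
propagating lines survive. The vertices of the edge that lie on one line have a common
representative, given by `ρ`, and `w` records the scalar of the line at this representative. -/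
structure Pairing (P : BlobParams k) (u t : HalfDiagram n) (ρ : Fin n → Fin n) (w : Fin n → k) :
    Prop where
  upper : ∀ i j, u.link i = .inl j → ρ i = ρ j
  lower : ∀ i j, t.link i = .inl j → ρ i = ρ j
  conn : ∀ i, Relation.ReflTransGen (fun i j => u.link i = .inl j ∨ t.link i = .inl j) i (ρ i)
  line : ∀ r, ρ r = r → LineScalar P u t {i | ρ i = r} (w r)
  eq_one : ∀ r, ρ r ≠ r → w r = 1

/-- All propagating lines survive when `u` is put on `t`, and `w` is the product of the scalars of
the lines. -/
def PairsTo (P : BlobParams k) (u t : HalfDiagram n) (w : k) : Prop :=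
  ∃ ρ f, Pairing P u t ρ f ∧ ∏ i, f i = w

theorem PairsTo.symm {P : BlobParams k} {u t : HalfDiagram n} {w : k} (h : PairsTo P u t w) :
    PairsTo P t u w := by
  obtain ⟨ρ, f, h, hw⟩ := h
  refine ⟨ρ, f, ⟨h.lower, h.upper,
    fun i => Relation.ReflTransGen.mono (fun _ _ => Or.symm) _ _ (h.conn i),
    fun r hr => (h.line r hr).symm, h.eq_one⟩, hw⟩

namespace Pairing

variable {P : BlobParams k} {u t : HalfDiagram n} {ρ : Fin n → Fin n} {w : Fin n → k}

theorem rho_rho (h : Pairing P u t ρ w) (i : Fin n) : ρ (ρ i) = ρ i := by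
  have hc := h.conn i
  have key (j) (hj : Relation.ReflTransGen
      (fun i j => u.link i = .inl j ∨ t.link i = .inl j) i j) : ρ j = ρ i := by
    induction hj with
    | refl => rfl
    | tail _ hs ih => exact (hs.elim (h.upper _ _) (h.lower _ _)).symm.trans ih
  exact key _ hc

/-- A line of the upper picture that propagates continues as a propagating line of the lower one at
the same position, and the scalar of this line is `1`. -/
theorem exists_lower (h : Pairing P u t ρ w) {i : Fin n} (hi : u.link i = .inr .prop) :
    ∃ j, ρ j = ρ i ∧ t.link j = .inr .prop ∧ u.propRank i = t.propRank j ∧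
      (∀ m, ρ m = ρ i → (u.link m).isRight → m = i) ∧
      (∀ m, ρ m = ρ i → (t.link m).isRight → m = j) ∧ w (ρ i) = 1 := by
  have hl := h.line (ρ i) (h.rho_rho i)
  generalize w (ρ i) = v at hl
  cases hl with
  | loop h1 h2 => exact absurd (by simp [hi]) (h1 i rfl)
  | through τ i' j h1 h2 h3 h4 h5 h6 h7 =>
    obtain rfl := h5 i rfl (by simp [hi])
    obtain rfl : τ = .prop := by simpa [hi] using h3.symm
    exact ⟨j, h2, h4, h7, h5, h6, rfl⟩
  | upper s i' j h1 h2 h3 h4 h5 h6 h7 =>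
    rcases h5 i rfl (by simp [hi]) with rfl | rfl <;> simp_all
  | lower s i' j h1 h2 h3 h4 h5 h6 h7 => exact absurd (by simp [hi]) (h6 i rfl)

theorem exists_upper (h : Pairing P u t ρ w) {j : Fin n} (hj : t.link j = .inr .prop) :
    ∃ i, ρ i = ρ j ∧ u.link i = .inr .prop ∧ u.propRank i = t.propRank j := by
  have hl := h.line (ρ j) (h.rho_rho j)
  generalize w (ρ j) = v at hl
  cases hl with
  | loop h1 h2 => exact absurd (by simp [hj]) (h2 j rfl)
  | through τ i j' h1 h2 h3 h4 h5 h6 h7 =>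
    obtain rfl := h6 j rfl (by simp [hj])
    obtain rfl : τ = .prop := by simpa [hj] using h4.symm
    exact ⟨i, h1, h3, h7⟩
  | upper s i' j h1 h2 h3 h4 h5 h6 h7 => exact absurd (by simp [hj]) (h6 _ rfl)
  | lower s i' j h1 h2 h3 h4 h5 h6 h7 =>
    rcases h5 _ rfl (by simp [hj]) with rfl | rfl <;> simp_all

end Pairing

open Classical in
/-- A label for the line through the vertex `i` of the common edge: its position if it propagates,
and its representative otherwise. -/
noncomputable def midLabel (u : HalfDiagram n) (ρ : Fin n → Fin n) (i : Fin n) : ℕ ⊕ Fin n :=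
  if h : ∃ m, ρ m = ρ i ∧ u.link m = .inr .prop then .inl (u.propRank h.choose) else .inr (ρ i)

/-- A label for the line at the vertex `i` of an outer edge: its position if it propagates, and its
leftmost vertex otherwise. -/
def strand (x : HalfDiagram n) (i : Fin n) : ℕ ⊕ Fin n :=
  match x.link i with
  | .inl j => .inr (min i j)
  | .inr .prop => .inl (x.propRank i)
  | .inr (.wall _) => .inr i

theorem strand_eq_inl_iff (x : HalfDiagram n) {i : Fin n} {m : ℕ} :
    x.strand i = .inl m ↔ x.link i = .inr .prop ∧ x.propRank i = m := by
  rw [strand]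
  rcases h : x.link i with j | s | _ <;> simp

theorem strand_eq_iff (x : HalfDiagram n) {i j : Fin n} :
    x.strand i = x.strand j ↔ i = j ∨ x.link i = .inl j := by
  have hs := x.link_symm
  have hr := x.propRank_inj (i := i) (j := j)
  have hi := hs i
  have hj := hs j
  constructor
  · intro h
    rw [strand, strand] at h
    rcases h1 : x.link i with i' | s | _ <;> rcases h2 : x.link j with j' | s' | _ <;>
      simp only [h1, h2, Sum.inr.injEq, Sum.inl.injEq, reduceCtorEq] at h ⊢
    · rcases min_choice i i' with ha | ha <;> rcases min_choice j j' with hb | hb <;>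
        rw [ha, hb] at h <;> subst h <;> grind
    · rcases min_choice i i' with ha | ha <;> grind
    · rcases min_choice j j' with ha | ha <;> grind
    · grind
    · grind
  · rintro (rfl | h)
    · rfl
    · simp [strand, h, hs _ _ h, min_comm]

namespace Pairing

variable {P : BlobParams k} {u t : HalfDiagram n} {ρ : Fin n → Fin n} {w : Fin n → k}

theorem midLabel_of_upper (h : Pairing P u t ρ w) {i : Fin n} (hi : u.link i = .inr .prop) :
    midLabel u ρ i = .inl (u.propRank i) := by
  have hex : ∃ m, ρ m = ρ i ∧ u.link m = .inr .prop := ⟨i, rfl, hi⟩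
  obtain ⟨j, -, -, -, h5, -, -⟩ := h.exists_lower hi
  rw [midLabel, dif_pos hex, h5 _ hex.choose_spec.1 (by simp [hex.choose_spec.2])]

theorem midLabel_congr {i j : Fin n} (hij : ρ i = ρ j) : midLabel u ρ i = midLabel u ρ j := by
  simp only [midLabel, hij]

theorem midLabel_of_lower (h : Pairing P u t ρ w) {j : Fin n} (hj : t.link j = .inr .prop) :
    midLabel u ρ j = .inl (t.propRank j) := by
  obtain ⟨i, h1, h2, h3⟩ := h.exists_upper hj
  rw [← midLabel_congr h1, h.midLabel_of_upper h2, h3]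

theorem midLabel_eq_inl {i : Fin n} {m : ℕ} (hi : midLabel u ρ i = .inl m) :
    ∃ j, ρ j = ρ i ∧ u.link j = .inr .prop ∧ u.propRank j = m := by
  rw [midLabel] at hi
  split_ifs at hi with h
  exact ⟨h.choose, h.choose_spec.1, h.choose_spec.2, by simpa using hi⟩

theorem midLabel_eq_inr {i r : Fin n} (hi : midLabel u ρ i = .inr r) : ρ i = r := by
  rw [midLabel] at hi
  split_ifs at hi with h
  simpa using hi

end Pairing

end HalfDiagram

/-! ### The lines of a concatenation -/

namespace Diagram

open HalfDiagram

variable {k : Type*} [Field k] {n : ℕ} {P : BlobParams k} {d₁ d₂ : Diagram n}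
  {ρ : Fin n → Fin n} {w : Fin n → k}

/-- A label for the line through a vertex of the concatenated picture: the position of the line if
it propagates, and a representative vertex on the same edge otherwise. -/
noncomputable def lineLabel (d₁ d₂ : Diagram n) (ρ : Fin n → Fin n) :
    Fin 3 × Fin n → ℕ ⊕ Fin 3 × Fin n
  | (0, i) => (d₁.top.strand i).map id (Prod.mk 0)
  | (1, i) => (midLabel d₁.bot ρ i).map id (Prod.mk 1)
  | (2, i) => (d₂.bot.strand i).map id (Prod.mk 2)

theorem lineLabel_zero (i : Fin n) :
    lineLabel d₁ d₂ ρ (0, i) = (d₁.top.strand i).map id (Prod.mk 0) := rfl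

theorem lineLabel_one (i : Fin n) :
    lineLabel d₁ d₂ ρ (1, i) = (midLabel d₁.bot ρ i).map id (Prod.mk 1) := rfl

theorem lineLabel_two (i : Fin n) :
    lineLabel d₁ d₂ ρ (2, i) = (d₂.bot.strand i).map id (Prod.mk 2) := rfl

theorem fst_eq_of_lineLabel {x r : Fin 3 × Fin n} (h : lineLabel d₁ d₂ ρ x = .inr r) :
    r.1 = x.1 := by
  obtain ⟨c, i⟩ := x
  fin_cases c
  · rw [Fin.zero_eta, lineLabel_zero] at h
    rcases hs : d₁.top.strand i with m | s <;> rw [hs] at h <;> cases h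
    rfl
  · rw [Fin.mk_one, lineLabel_one] at h
    rcases hs : midLabel d₁.bot ρ i with m | s <;> rw [hs] at h <;> cases h
    rfl
  · change lineLabel d₁ d₂ ρ (2, i) = _ at h
    rw [lineLabel_two] at h
    rcases hs : d₂.bot.strand i with m | s <;> rw [hs] at h <;> cases h
    rfl

theorem map_eq_inr {s : ℕ ⊕ Fin n} {c : Fin 3} {r : Fin 3 × Fin n}
    (h : s.map id (Prod.mk c) = .inr r) : s = .inr r.2 := by
  rcases s with m | s <;> cases h
  rfl

theorem map_mk_injective {c : Fin 3} :
    Function.Injective (Sum.map id (Prod.mk c) : ℕ ⊕ Fin n → ℕ ⊕ Fin 3 × Fin n) :=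
  Sum.map_injective.2 ⟨Function.injective_id, Prod.mk_right_injective c⟩

theorem lineLabel_eq_of_reachable (h : Pairing P d₁.bot d₂.top ρ w) {x y : Fin 3 × Fin n}
    (hxy : (glue d₁ d₂).Reachable x y) : lineLabel d₁ d₂ ρ x = lineLabel d₁ d₂ ρ y := by
  refine eq_of_reachable _ ?_ ?_ hxy
  · have key (i j : Fin n) (hij : d₁.lineAdj (.inl i) (.inr j)) :
        lineLabel d₁ d₂ ρ (0, i) = lineLabel d₁ d₂ ρ (1, j) := by
      obtain ⟨h1, h2, h3⟩ := hij
      rw [lineLabel_zero, lineLabel_one, h.midLabel_of_upper h2, strand_eq_inl_iff _ |>.2 ⟨h1, h3⟩]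
      rfl
    rintro (i | i) (j | j) hij
    · exact congrArg (Sum.map id (Prod.mk 0)) ((strand_eq_iff _).2 (.inr hij))
    · exact key i j hij
    · exact (key j i hij).symm
    · exact congrArg (Sum.map id (Prod.mk 1)) (Pairing.midLabel_congr (h.upper i j hij))
  · have key (i j : Fin n) (hij : d₂.lineAdj (.inl i) (.inr j)) :
        lineLabel d₁ d₂ ρ (1, i) = lineLabel d₁ d₂ ρ (2, j) := by
      obtain ⟨h1, h2, h3⟩ := hij
      rw [lineLabel_one, lineLabel_two, h.midLabel_of_lower h1,
        strand_eq_inl_iff _ |>.2 ⟨h2, h3.symm⟩]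
      rfl
    rintro (i | i) (j | j) hij
    · exact congrArg (Sum.map id (Prod.mk 1)) (Pairing.midLabel_congr (h.lower i j hij))
    · exact key i j hij
    · exact (key j i hij).symm
    · exact congrArg (Sum.map id (Prod.mk 2)) ((strand_eq_iff _).2 (.inr hij))

theorem reachable_of_rho_eq (h : Pairing P d₁.bot d₂.top ρ w) {i j : Fin n} (hij : ρ i = ρ j) :
    (glue d₁ d₂).Reachable (1, i) (1, j) := by
  have key (i : Fin n) : (glue d₁ d₂).Reachable (1, i) (1, ρ i) := by
    have hc := h.conn i
    generalize ρ i = r at hc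
    induction hc with
    | refl => rfl
    | tail _ hs ih =>
      refine ih.trans ?_
      rcases hs with hs | hs
      · exact reachable_upper (u := .inr _) (v := .inr _) hs
      · exact reachable_lower (u := .inl _) (v := .inl _) hs
  exact (key i).trans (hij ▸ (key j).symm)

theorem exists_reachable_of_lineLabel_eq_inl (h : Pairing P d₁.bot d₂.top ρ w)
    {x : Fin 3 × Fin n} {m : ℕ} (hx : lineLabel d₁ d₂ ρ x = .inl m) :
    ∃ i, d₁.bot.link i = .inr .prop ∧ d₁.bot.propRank i = m ∧ (glue d₁ d₂).Reachable x (1, i) := by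
  obtain ⟨c, i⟩ := x
  fin_cases c
  · obtain ⟨m', hm', rfl⟩ : ∃ m', d₁.top.strand i = .inl m' ∧ m' = m := by
      rcases hs : d₁.top.strand i with m' | r
      · exact ⟨m', rfl, by simpa [lineLabel, hs] using hx⟩
      · simp [lineLabel, hs] at hx
    obtain ⟨h1, rfl⟩ := (strand_eq_inl_iff _).1 hm'
    obtain ⟨j, h2, h3⟩ := d₁.bot.exists_propRank_eq (d₁.prop_eq ▸ d₁.top.propRank_lt_count h1)
    exact ⟨j, h2, h3, reachable_upper (u := .inl i) (v := .inr j) ⟨h1, h2, h3.symm⟩⟩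
  · obtain ⟨m', hm', rfl⟩ : ∃ m', midLabel d₁.bot ρ i = .inl m' ∧ m' = m := by
      rcases hs : midLabel d₁.bot ρ i with m' | r
      · exact ⟨m', rfl, by simpa [lineLabel, hs] using hx⟩
      · simp [lineLabel, hs] at hx
    obtain ⟨j, h1, h2, h3⟩ := Pairing.midLabel_eq_inl hm'
    exact ⟨j, h2, h3, reachable_of_rho_eq h h1.symm⟩
  · obtain ⟨m', hm', rfl⟩ : ∃ m', d₂.bot.strand i = .inl m' ∧ m' = m := by
      rcases hs : d₂.bot.strand i with m' | r
      · exact ⟨m', rfl, by simpa [lineLabel, hs] using hx⟩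
      · simp [lineLabel, hs] at hx
    obtain ⟨h1, rfl⟩ := (strand_eq_inl_iff _).1 hm'
    obtain ⟨j, h2, h3⟩ := d₂.top.exists_propRank_eq (d₂.prop_eq ▸ d₂.bot.propRank_lt_count h1)
    obtain ⟨j', h4, h5, h6⟩ := h.exists_upper h2
    exact ⟨j', h5, h6.trans h3, (reachable_lower (u := .inr i) (v := .inl j) ⟨h2, h1, h3⟩).trans
      (reachable_of_rho_eq h h4.symm)⟩

/-- The label tells the lines of the concatenated picture apart. -/
theorem reachable_iff (h : Pairing P d₁.bot d₂.top ρ w) {x y : Fin 3 × Fin n} :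
    (glue d₁ d₂).Reachable x y ↔ lineLabel d₁ d₂ ρ x = lineLabel d₁ d₂ ρ y := by
  refine ⟨lineLabel_eq_of_reachable h, fun hxy => ?_⟩
  rcases hx : lineLabel d₁ d₂ ρ x with m | r
  · obtain ⟨i, h1, h2, h3⟩ := exists_reachable_of_lineLabel_eq_inl h hx
    obtain ⟨j, h4, h5, h6⟩ := exists_reachable_of_lineLabel_eq_inl h (hxy ▸ hx)
    obtain rfl := d₁.bot.propRank_inj h1 h4 (h2.trans h5.symm)
    exact h3.trans h6.symm
  · have hy := hxy ▸ hx
    obtain ⟨c, i⟩ := x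
    obtain ⟨c', j⟩ := y
    obtain rfl : c = c' := (fst_eq_of_lineLabel hx).symm.trans (fst_eq_of_lineLabel hy)
    fin_cases c
    · rcases (strand_eq_iff _).1 ((map_eq_inr hx).trans (map_eq_inr hy).symm) with rfl | h3
      · rfl
      · exact reachable_upper (u := .inl i) (v := .inl j) h3
    · exact reachable_of_rho_eq h ((Pairing.midLabel_eq_inr (map_eq_inr hx)).trans
        (Pairing.midLabel_eq_inr (map_eq_inr hy)).symm)
    · rcases (strand_eq_iff _).1 ((map_eq_inr hx).trans (map_eq_inr hy).symm) with rfl | h3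
      · rfl
      · exact reachable_lower (u := .inr i) (v := .inr j) h3

theorem midLabel_of_upper_wall (h : Pairing P d₁.bot d₂.top ρ w) {i : Fin n} {s : Wall}
    (hi : d₁.bot.link i = .inr (.wall s)) : midLabel d₁.bot ρ i = .inr (ρ i) := by
  rcases hl : midLabel d₁.bot ρ i with m | r
  · obtain ⟨j, h1, h2, -⟩ := Pairing.midLabel_eq_inl hl
    obtain ⟨-, -, -, -, h3, -, -⟩ := h.exists_lower h2
    obtain rfl := h3 i h1.symm (by simp [hi])
    simp [hi] at h2
  · rw [Pairing.midLabel_eq_inr hl]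

theorem midLabel_of_lower_wall (h : Pairing P d₁.bot d₂.top ρ w) {i : Fin n} {s : Wall}
    (hi : d₂.top.link i = .inr (.wall s)) : midLabel d₁.bot ρ i = .inr (ρ i) := by
  rcases hl : midLabel d₁.bot ρ i with m | r
  · obtain ⟨j, h1, h2, -⟩ := Pairing.midLabel_eq_inl hl
    obtain ⟨j', -, h3, -, -, h4, -⟩ := h.exists_lower h2
    obtain rfl := h4 i h1.symm (by simp [hi])
    simp [hi] at h3
  · rw [Pairing.midLabel_eq_inr hl]

theorem strand_of_wall {x : HalfDiagram n} {i : Fin n} {s : Wall}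
    (hi : x.link i = .inr (.wall s)) : x.strand i = .inr i := by
  rw [strand, hi]

theorem exists_lineLabel_upper (h : Pairing P d₁.bot d₂.top ρ w) {u : Fin n ⊕ Fin n} {s : Wall}
    (hu : d₁.linkAt u = .inr (.wall s)) : ∃ r, lineLabel d₁ d₂ ρ (placeUpper u) = .inr r := by
  rcases u with i | i
  · exact ⟨_, congrArg (Sum.map id (Prod.mk 0)) (strand_of_wall hu)⟩
  · exact ⟨_, congrArg (Sum.map id (Prod.mk 1)) (midLabel_of_upper_wall h hu)⟩

theorem exists_lineLabel_lower (h : Pairing P d₁.bot d₂.top ρ w) {u : Fin n ⊕ Fin n} {s : Wall}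
    (hu : d₂.linkAt u = .inr (.wall s)) : ∃ r, lineLabel d₁ d₂ ρ (placeLower u) = .inr r := by
  rcases u with i | i
  · exact ⟨_, congrArg (Sum.map id (Prod.mk 1)) (midLabel_of_lower_wall h hu)⟩
  · exact ⟨_, congrArg (Sum.map id (Prod.mk 2)) (strand_of_wall hu)⟩

theorem fst_eq_of_upper (h : Pairing P d₁.bot d₂.top ρ w) {u : Fin n ⊕ Fin n} {s : Wall}
    (hu : d₁.linkAt u = .inr (.wall s)) {x : Fin 3 × Fin n}
    (hx : (glue d₁ d₂).Reachable (placeUpper u) x) : (placeUpper u).1 = x.1 := by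
  obtain ⟨r, hr⟩ := exists_lineLabel_upper h hu
  exact (fst_eq_of_lineLabel hr).symm.trans (fst_eq_of_lineLabel ((reachable_iff h).1 hx ▸ hr))

theorem fst_eq_of_lower (h : Pairing P d₁.bot d₂.top ρ w) {u : Fin n ⊕ Fin n} {s : Wall}
    (hu : d₂.linkAt u = .inr (.wall s)) {x : Fin 3 × Fin n}
    (hx : (glue d₁ d₂).Reachable (placeLower u) x) : (placeLower u).1 = x.1 := by
  obtain ⟨r, hr⟩ := exists_lineLabel_lower h hu
  exact (fst_eq_of_lineLabel hr).symm.trans (fst_eq_of_lineLabel ((reachable_iff h).1 hx ▸ hr))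

theorem eq_of_strand_eq {x : HalfDiagram n} {i j : Fin n} {τ : Terminus}
    (hi : x.link i = .inr τ) (h : x.strand i = x.strand j) : i = j := by
  rcases (strand_eq_iff _).1 h with h | h
  · exact h
  · simp [hi] at h

theorem isHalfOfGlue_top (h : Pairing P d₁.bot d₂.top ρ w) :
    IsHalfOfGlue d₁ d₂ 0 2 d₁.top := by
  intro i
  refine ⟨fun j => ?_, ?_, fun s => ?_⟩
  · rw [reachable_iff h, lineLabel_zero, lineLabel_zero, map_mk_injective.eq_iff, strand_eq_iff]
    constructor
    · intro hl
      exact ⟨fun e => d₁.top.link_ne i (e ▸ hl), .inr hl⟩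
    · rintro ⟨h1, h2 | h2⟩
      · exact absurd h2.symm h1
      · exact h2
  · constructor
    · intro hi
      obtain ⟨i', h1, h2⟩ := d₁.bot.exists_propRank_eq (d₁.prop_eq ▸ d₁.top.propRank_lt_count hi)
      obtain ⟨j, h3, h4, h5, -⟩ := h.exists_lower h1
      obtain ⟨j', h6, h7⟩ := d₂.bot.exists_propRank_eq (d₂.prop_eq ▸ d₂.top.propRank_lt_count h4)
      refine ⟨j', (reachable_iff h).2 ?_⟩
      rw [lineLabel_zero, lineLabel_two, (strand_eq_inl_iff _).2 ⟨hi, rfl⟩,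
        (strand_eq_inl_iff _).2 ⟨h6, rfl⟩, ← h2, h5, h7]
      rfl
    · rintro ⟨j, hj⟩
      rw [reachable_iff h] at hj
      rcases hs : d₁.top.strand i with m | r
      · exact ((strand_eq_inl_iff _).1 hs).1
      · rw [lineLabel_zero, hs] at hj
        exact absurd (fst_eq_of_lineLabel hj.symm) (by simp)
  · constructor
    · intro hi
      exact ⟨_, .inl ⟨.inl i, rfl, hi, rfl⟩⟩
    · rintro ⟨p, ⟨u, hu, hl, -⟩ | ⟨u, hu, hl, -⟩⟩
      all_goals rw [SimpleGraph.ConnectedComponent.mem_supp_iff,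
        SimpleGraph.ConnectedComponent.eq] at hu
      · have hf := fst_eq_of_upper h hl hu
        rcases u with j | j
        · exact eq_of_strand_eq hl (map_mk_injective ((reachable_iff h).1 hu)) ▸ hl
        · simp [placeUpper] at hf
      · have hf := fst_eq_of_lower h hl hu
        rcases u with j | j <;> simp [placeLower] at hf

theorem isHalfOfGlue_bot (h : Pairing P d₁.bot d₂.top ρ w) :
    IsHalfOfGlue d₁ d₂ 2 0 d₂.bot := by
  intro i
  refine ⟨fun j => ?_, ?_, fun s => ?_⟩
  · rw [reachable_iff h, lineLabel_two, lineLabel_two, map_mk_injective.eq_iff, strand_eq_iff]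
    constructor
    · intro hl
      exact ⟨fun e => d₂.bot.link_ne i (e ▸ hl), .inr hl⟩
    · rintro ⟨h1, h2 | h2⟩
      · exact absurd h2.symm h1
      · exact h2
  · constructor
    · intro hi
      obtain ⟨i', h1, h2⟩ := d₂.top.exists_propRank_eq (d₂.prop_eq ▸ d₂.bot.propRank_lt_count hi)
      obtain ⟨j, h3, h4, h5⟩ := h.exists_upper h1
      obtain ⟨j', h6, h7⟩ := d₁.top.exists_propRank_eq (d₁.prop_eq ▸ d₁.bot.propRank_lt_count h4)
      refine ⟨j', (reachable_iff h).2 ?_⟩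
      rw [lineLabel_zero, lineLabel_two, (strand_eq_inl_iff _).2 ⟨hi, rfl⟩,
        (strand_eq_inl_iff _).2 ⟨h6, rfl⟩, ← h2, ← h5, h7]
      rfl
    · rintro ⟨j, hj⟩
      rw [reachable_iff h] at hj
      rcases hs : d₂.bot.strand i with m | r
      · exact ((strand_eq_inl_iff _).1 hs).1
      · rw [lineLabel_two, hs] at hj
        exact absurd (fst_eq_of_lineLabel hj.symm) (by simp)
  · constructor
    · intro hi
      exact ⟨_, .inr ⟨.inr i, rfl, hi, rfl⟩⟩
    · rintro ⟨p, ⟨u, hu, hl, -⟩ | ⟨u, hu, hl, -⟩⟩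
      all_goals rw [SimpleGraph.ConnectedComponent.mem_supp_iff,
        SimpleGraph.ConnectedComponent.eq] at hu
      · have hf := fst_eq_of_upper h hl hu
        rcases u with j | j <;> simp [placeUpper] at hf
      · have hf := fst_eq_of_lower h hl hu
        rcases u with j | j
        · simp [placeLower] at hf
        · exact eq_of_strand_eq hl (map_mk_injective ((reachable_iff h).1 hu)) ▸ hl

/-- If the propagating lines of the two diagrams survive, then their outer halves form the
composite. -/
theorem isComposite_of_pairing (h : Pairing P d₁.bot d₂.top ρ w) {d₃ : Diagram n}
    (htop : d₃.top = d₁.top) (hbot : d₃.bot = d₂.bot) : IsComposite d₁ d₂ d₃ :=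
  ⟨htop ▸ isHalfOfGlue_top h, hbot ▸ isHalfOfGlue_bot h⟩

/-! ### The scalar of a concatenation -/

/-- The end points on the wall `s` of a line that stays inside the concatenated picture. -/
theorem mem_wallEnds_iff (h : Pairing P d₁.bot d₂.top ρ w) {r : Fin n}
    (hr : midLabel d₁.bot ρ r = .inr r) {s : Wall} {p : ℕ} :
    p ∈ wallEnds d₁ d₂ ((glue d₁ d₂).connectedComponentMk (1, r)) s ↔
      (∃ i, ρ i = r ∧ d₁.bot.link i = .inr (.wall s) ∧
        p = d₁.wallCount s - 1 - d₁.bot.nearer s i) ∨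
      (∃ i, ρ i = r ∧ d₂.top.link i = .inr (.wall s) ∧
        p = d₁.wallCount s + d₂.top.nearer s i) := by
  have hρ := Pairing.midLabel_eq_inr hr
  simp only [wallEnds, Set.mem_ofPred_eq, SimpleGraph.ConnectedComponent.mem_supp_iff,
    SimpleGraph.ConnectedComponent.eq]
  refine or_congr ⟨?_, ?_⟩ ⟨?_, ?_⟩
  · rintro ⟨u, hu, hl, rfl⟩
    have hf := fst_eq_of_upper h hl hu
    rcases u with j | j
    · simp [placeUpper] at hf
    · refine ⟨j, ?_, hl, rfl⟩
      have := map_mk_injective ((reachable_iff h).1 hu)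
      rw [hr] at this
      exact Pairing.midLabel_eq_inr this
  · rintro ⟨i, hi, hl, rfl⟩
    exact ⟨.inr i, reachable_of_rho_eq h (hi.trans hρ.symm), hl, rfl⟩
  · rintro ⟨u, hu, hl, rfl⟩
    have hf := fst_eq_of_lower h hl hu
    rcases u with j | j
    · refine ⟨j, ?_, hl, rfl⟩
      have := map_mk_injective ((reachable_iff h).1 hu)
      rw [hr] at this
      exact Pairing.midLabel_eq_inr this
    · simp [placeLower] at hf
  · rintro ⟨i, hi, hl, rfl⟩
    exact ⟨.inl i, reachable_of_rho_eq h (hi.trans hρ.symm), hl, rfl⟩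

/-- A line is inner exactly if it meets the common edge and does not propagate. -/
theorem isInner_iff (h : Pairing P d₁.bot d₂.top ρ w) {c : (glue d₁ d₂).ConnectedComponent} :
    IsInner d₁ d₂ c ↔ ∃ r, midLabel d₁.bot ρ r = .inr r ∧
      c = (glue d₁ d₂).connectedComponentMk (1, r) := by
  constructor
  · intro hc
    obtain ⟨⟨e, i⟩, rfl⟩ := c.exists_rep
    obtain rfl : e = 1 := hc (e, i) rfl
    have key : midLabel d₁.bot ρ i = .inr (ρ i) := by
      rcases hl : midLabel d₁.bot ρ i with m | r
      · obtain ⟨j, h1, h2, h3⟩ := Pairing.midLabel_eq_inl hl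
        obtain ⟨i', h4, h5⟩ := d₁.top.exists_propRank_eq (d₁.prop_eq ▸ d₁.bot.propRank_lt_count h2)
        have hr := (reachable_upper (d₁ := d₁) (d₂ := d₂) (u := .inl i') (v := .inr j)
          ⟨h4, h2, h5⟩).trans (reachable_of_rho_eq h h1)
        exact absurd (hc (0, i') (SimpleGraph.ConnectedComponent.eq.2 hr)) (by simp)
      · rw [Pairing.midLabel_eq_inr hl]
    refine ⟨ρ i, ?_, SimpleGraph.ConnectedComponent.eq.2
      (reachable_of_rho_eq h (h.rho_rho i).symm)⟩
    rw [Pairing.midLabel_congr (h.rho_rho i), key]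
  · rintro ⟨r, hr, rfl⟩ a ha
    have hra := (reachable_iff h).1 (SimpleGraph.ConnectedComponent.eq.1 ha)
    rw [lineLabel_one, hr] at hra
    exact (fst_eq_of_lineLabel hra).symm

end Diagram

namespace Diagram

open HalfDiagram

variable {k : Type*} [Field k] {n : ℕ} {P : BlobParams k} {d₁ d₂ : Diagram n}
  {ρ : Fin n → Fin n} {w : Fin n → k}

theorem lineWeight_eq_wallScalar (P : BlobParams k) {c : (glue d₁ d₂).ConnectedComponent}
    (hc : IsInner d₁ d₂ c) {s : Wall} {m : ℕ} (hm : IsLeast (wallEnds d₁ d₂ c s) m)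
    (he : ∀ s', s' ≠ s → wallEnds d₁ d₂ c s' = ∅) :
    lineWeight P d₁ d₂ c = P.wallScalar s m := by
  have hne : wallEnds d₁ d₂ c s ≠ ∅ := fun h => by simpa [h] using hm.1
  have hs : sInf (wallEnds d₁ d₂ c s) = m := hm.csInf_eq
  cases s
  · rw [lineWeight, if_pos hc, if_neg hne, if_pos (he .right (by simp)), hs]
    rfl
  · rw [lineWeight, if_pos hc, if_pos (he .left (by simp)), if_neg hne, hs]
    rfl

/-- The scalar of a line that stays inside the concatenated picture, and the fact that this line
does not join the two walls. -/
theorem lineWeight_of_pairing (h : Pairing P d₁.bot d₂.top ρ w) (hp : d₁.top.count .prop ≠ 0)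
    {r : Fin n} (hr : midLabel d₁.bot ρ r = .inr r) :
    lineWeight P d₁ d₂ ((glue d₁ d₂).connectedComponentMk (1, r)) = w r ∧
      ∃ s, wallEnds d₁ d₂ ((glue d₁ d₂).connectedComponentMk (1, r)) s = ∅ := by
  have hc : IsInner d₁ d₂ ((glue d₁ d₂).connectedComponentMk (1, r)) :=
    (isInner_iff h).2 ⟨r, hr, rfl⟩
  have hmem := fun s p => mem_wallEnds_iff h hr (s := s) (p := p)
  have hl := h.line r (Pairing.midLabel_eq_inr hr)
  have hwall (s : Wall) := d₁.even_wallCount hp s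
  have hlt (s : Wall) (i : Fin n) (hi : d₁.bot.link i = .inr (.wall s)) :
      d₁.bot.nearer s i < d₁.wallCount s :=
    (d₁.bot.nearer_lt_count hi).trans_le (by rw [wallCount]; omega)
  generalize w r = v at hl
  cases hl with
  | loop h1 h2 =>
    have he (s : Wall) : wallEnds d₁ d₂ ((glue d₁ d₂).connectedComponentMk (1, r)) s = ∅ := by
      refine Set.eq_empty_iff_forall_notMem.2 fun p hp => ?_
      rcases (hmem s p).1 hp with ⟨i, hi, hl, -⟩ | ⟨i, hi, hl, -⟩
      · exact h1 i hi (by simp [hl])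
      · exact h2 i hi (by simp [hl])
    refine ⟨?_, .left, he .left⟩
    rw [lineWeight, if_pos hc, if_pos (he .left), if_pos (he .right)]
  | through τ i j h1 h2 h3 h4 h5 h6 h7 =>
    cases τ with
    | prop =>
      have := h.midLabel_of_upper h3
      rw [Pairing.midLabel_congr (h1.trans (Pairing.midLabel_eq_inr hr).symm), hr] at this
      cases this
    | wall s =>
      have he (s' : Wall) (hs : s' ≠ s) :
          wallEnds d₁ d₂ ((glue d₁ d₂).connectedComponentMk (1, r)) s' = ∅ := by
        refine Set.eq_empty_iff_forall_notMem.2 fun p hp => ?_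
        rcases (hmem s' p).1 hp with ⟨m, hm, hl, -⟩ | ⟨m, hm, hl, -⟩
        · obtain rfl := h5 m hm (by simp [hl])
          exact hs (by simpa [h3] using hl.symm)
        · obtain rfl := h6 m hm (by simp [hl])
          exact hs (by simpa [h4] using hl.symm)
      refine ⟨?_, by cases s <;> [exact ⟨_, he .right (by simp)⟩; exact ⟨_, he .left (by simp)⟩]⟩
      rw [lineWeight_eq_wallScalar P hc (s := s) (m := d₁.wallCount s - 1 - d₁.bot.nearer s i) ?_
        he]
      -- The number of points of `d₁` on the wall is even, so this is `nearer + 1` modulo two.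
      · refine P.wallScalar_congr s ?_
        have := hlt s i h3
        have := hwall s
        grind
      · refine ⟨(hmem s _).2 (.inl ⟨i, h1, h3, rfl⟩), fun p hp => ?_⟩
        rcases (hmem s p).1 hp with ⟨m, hm, hl, rfl⟩ | ⟨m, hm, hl, rfl⟩
        · obtain rfl := h5 m hm (by simp [hl])
          exact le_rfl
        · omega
  | upper s i j h1 h2 h3 h4 h5 h6 h7 =>
    have he (s' : Wall) (hs : s' ≠ s) :
        wallEnds d₁ d₂ ((glue d₁ d₂).connectedComponentMk (1, r)) s' = ∅ := by
      refine Set.eq_empty_iff_forall_notMem.2 fun p hp => ?_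
      rcases (hmem s' p).1 hp with ⟨m, hm, hl, -⟩ | ⟨m, hm, hl, -⟩
      · rcases h5 m hm (by simp [hl]) with rfl | rfl
        · exact hs (by simpa [h3] using hl.symm)
        · exact hs (by simpa [h4] using hl.symm)
      · exact h6 m hm (by simp [hl])
    refine ⟨?_, by cases s <;> [exact ⟨_, he .right (by simp)⟩; exact ⟨_, he .left (by simp)⟩]⟩
    rw [lineWeight_eq_wallScalar P hc (s := s) (m := d₁.wallCount s - 1 - d₁.bot.nearer s j) ?_ he]
    · refine P.wallScalar_congr s ?_
      have := hlt s j h4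
      have := hwall s
      grind
    · refine ⟨(hmem s _).2 (.inl ⟨j, h2, h4, rfl⟩), fun p hp => ?_⟩
      rcases (hmem s p).1 hp with ⟨m, hm, hl, rfl⟩ | ⟨m, hm, hl, rfl⟩
      · rcases h5 m hm (by simp [hl]) with rfl | rfl
        · omega
        · exact le_rfl
      · omega
  | lower s i j h1 h2 h3 h4 h5 h6 h7 =>
    have he (s' : Wall) (hs : s' ≠ s) :
        wallEnds d₁ d₂ ((glue d₁ d₂).connectedComponentMk (1, r)) s' = ∅ := by
      refine Set.eq_empty_iff_forall_notMem.2 fun p hp => ?_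
      rcases (hmem s' p).1 hp with ⟨m, hm, hl, -⟩ | ⟨m, hm, hl, -⟩
      · exact h6 m hm (by simp [hl])
      · rcases h5 m hm (by simp [hl]) with rfl | rfl
        · exact hs (by simpa [h3] using hl.symm)
        · exact hs (by simpa [h4] using hl.symm)
    refine ⟨?_, by cases s <;> [exact ⟨_, he .right (by simp)⟩; exact ⟨_, he .left (by simp)⟩]⟩
    rw [lineWeight_eq_wallScalar P hc (s := s) (m := d₁.wallCount s + d₂.top.nearer s i) ?_ he]
    · refine P.wallScalar_congr s ?_
      have := hwall s
      grind
    · refine ⟨(hmem s _).2 (.inr ⟨i, h1, h3, rfl⟩), fun p hp => ?_⟩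
      rcases (hmem s p).1 hp with ⟨m, hm, hl, rfl⟩ | ⟨m, hm, hl, rfl⟩
      · exact absurd (by simp [hl]) (h6 m hm)
      · rcases h5 m hm (by simp [hl]) with rfl | rfl
        · exact le_rfl
        · omega

theorem crossCount_eq_zero (h : Pairing P d₁.bot d₂.top ρ w) (hp₁ : d₁.top.count .prop ≠ 0)
    (hp₂ : d₂.top.count .prop ≠ 0) : crossCount d₁ d₂ = 0 := by
  rw [crossCount, d₁.crossLines_eq_zero hp₁, d₂.crossLines_eq_zero hp₂, zero_add, zero_add]
  refine (Set.ncard_eq_zero (Set.toFinite _)).2 (Set.eq_empty_iff_forall_notMem.2 ?_)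
  rintro c ⟨hc, h1, h2⟩
  obtain ⟨r, hr, rfl⟩ := (isInner_iff h).1 hc
  obtain ⟨s, hs⟩ := (lineWeight_of_pairing h hp₁ hr).2
  cases s
  · exact h1.ne_empty hs
  · exact h2.ne_empty hs

theorem coeff_of_pairing (h : Pairing P d₁.bot d₂.top ρ w) (hp₁ : d₁.top.count .prop ≠ 0)
    (hp₂ : d₂.top.count .prop ≠ 0) : coeff P d₁ d₂ = ∏ i, w i := by
  classical
  have : Fintype (glue d₁ d₂).ConnectedComponent := Fintype.ofFinite _
  rw [coeff, crossCount_eq_zero h hp₁ hp₂, Nat.zero_div, pow_zero, one_mul,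
    finprod_eq_prod_of_fintype]
  symm
  rw [← Finset.prod_filter_of_ne (p := fun r => midLabel d₁.bot ρ r = .inr r)]
  · refine Finset.prod_of_injOn (fun r => (glue d₁ d₂).connectedComponentMk (1, r)) ?_
      (fun _ _ => by simp) ?_ ?_
    · intro r hr r' hr' hrr
      have h1 : midLabel d₁.bot ρ r = .inr r := by simpa using hr
      have h2 : midLabel d₁.bot ρ r' = .inr r' := by simpa using hr'
      have h3 := (reachable_iff h).1 (SimpleGraph.ConnectedComponent.eq.1 hrr)
      rw [lineLabel_one, lineLabel_one, h1, h2] at h3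
      exact Sum.inr_injective (map_mk_injective h3)
    · intro c _ hc
      rw [lineWeight, if_neg]
      intro hin
      obtain ⟨r, hr, rfl⟩ := (isInner_iff h).1 hin
      exact hc ⟨r, by simpa using hr, rfl⟩
    · intro r hr
      exact (lineWeight_of_pairing h hp₁ (by simpa using hr)).1.symm
  · intro r _ hr
    by_cases hρ : ρ r = r
    · rcases hl : midLabel d₁.bot ρ r with m | r'
      · obtain ⟨j, h1, h2, h3⟩ := Pairing.midLabel_eq_inl hl
        obtain ⟨-, -, -, -, -, -, h4⟩ := h.exists_lower h2
        rw [h1, hρ] at h4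
        exact absurd h4 hr
      · rw [← Pairing.midLabel_eq_inr hl, hρ]
    · exact absurd (h.eq_one r hρ) hr

end Diagram

namespace BlobSpace

open HalfDiagram

variable {k : Type*} [Field k] {n : ℕ}

/-- If the lower half of `d₁` and the upper half of `d₂` pair to `w`, then the product is `w` times
the diagram formed by the outer halves. -/
theorem mulDiagram_of_pairsTo {P : BlobParams k} {d₁ d₂ d₃ : Diagram n} {w : k}
    (h : PairsTo P d₁.bot d₂.top w) (htop : d₃.top = d₁.top) (hbot : d₃.bot = d₂.bot)
    (hp : d₃.top.count .prop ≠ 0) : mulDiagram P d₁ d₂ = Finsupp.single d₃ w := by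
  obtain ⟨ρ, f, hf, rfl⟩ := h
  have hp₂ : d₂.top.count .prop ≠ 0 := by rwa [d₂.prop_eq, ← hbot, ← d₃.prop_eq]
  rw [mulDiagram_of_isComposite P (Diagram.isComposite_of_pairing hf htop hbot),
    Diagram.coeff_of_pairing hf (htop ▸ hp) hp₂]

end BlobSpace

namespace HalfDiagram

variable {n : ℕ}

/-- When `u` is put on `t`, there are vertices on the common edge, closed under the arcs on both
sides, from which lines propagate to exactly one side. Then propagating lines are lost. -/
def Blocked (u t : HalfDiagram n) : Prop :=
  ∃ C : Set (Fin n), (∀ i ∈ C, ∀ j, u.link i = .inl j → j ∈ C) ∧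
    (∀ i ∈ C, ∀ j, t.link i = .inl j → j ∈ C) ∧
    ((∀ i ∈ C, u.link i ≠ .inr .prop) ∧ (∃ i ∈ C, t.link i = .inr .prop) ∨
      (∀ i ∈ C, t.link i ≠ .inr .prop) ∧ ∃ i ∈ C, u.link i = .inr .prop)

theorem Blocked.symm {u t : HalfDiagram n} (h : Blocked u t) : Blocked t u := by
  obtain ⟨C, h1, h2, h3⟩ := h
  exact ⟨C, h2, h1, h3.symm⟩

end HalfDiagram

namespace Diagram

open HalfDiagram

variable {n : ℕ} {d₁ d₂ d₃ : Diagram n}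

theorem not_isComposite_of_blocked (h : Blocked d₁.bot d₂.top) (htop : d₃.top = d₁.top)
    (hbot : d₃.bot = d₂.bot) : ¬ IsComposite d₁ d₂ d₃ := by
  obtain ⟨C, h1, h2, ⟨h3, i, hi, hip⟩ | ⟨h3, i, hi, hip⟩⟩ := h
  -- The line that propagates down from `i` cannot leave `C` upwards.
  · rintro ⟨-, hc⟩
    obtain ⟨l, hl, hli⟩ := d₂.bot.exists_propRank_eq (d₂.prop_eq ▸ d₂.top.propRank_lt_count hip)
    obtain ⟨j, hj⟩ := (hc l).2.1.1 (hbot ▸ hl)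
    have := mem_of_reachable (d₁ := d₁) (d₂ := d₂)
      ({x | x.1 = 1 ∧ x.2 ∈ C ∨ x.1 = 2 ∧ d₂.bot.link x.2 = .inr .prop ∧
        ∃ i ∈ C, d₂.top.link i = .inr .prop ∧ d₂.top.propRank i = d₂.bot.propRank x.2})
      ?_ ?_ hj (.inr ⟨rfl, hl, i, hi, hip, hli.symm⟩)
    · simp at this
    · rintro (u | u) (v | v) huv hu
      · simp [placeUpper] at hu
      · simp [placeUpper] at hu
      · have : u ∈ C := by simpa [placeUpper] using hu
        exact absurd huv.2.1 (h3 u this)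
      · have : u ∈ C := by simpa [placeUpper] using hu
        exact .inl ⟨rfl, h1 u this v huv⟩
    · rintro (u | u) (v | v) huv hu
      · have : u ∈ C := by simpa [placeLower] using hu
        exact .inl ⟨rfl, h2 u this v huv⟩
      · have : u ∈ C := by simpa [placeLower] using hu
        exact .inr ⟨rfl, huv.2.1, u, this, huv.1, huv.2.2⟩
      · obtain ⟨-, i', h4, h5, h6⟩ : _ ∧ ∃ i ∈ C, d₂.top.link i = .inr .prop ∧
          d₂.top.propRank i = d₂.bot.propRank u := by simpa [placeLower] using hu
        obtain rfl := d₂.top.propRank_inj h5 huv.1 (h6.trans huv.2.2.symm)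
        exact .inl ⟨rfl, h4⟩
      · have h4 : d₂.bot.link u = .inl v := huv
        simp [placeLower, h4] at hu
  · rintro ⟨hc, -⟩
    obtain ⟨l, hl, hli⟩ := d₁.top.exists_propRank_eq (d₁.prop_eq ▸ d₁.bot.propRank_lt_count hip)
    obtain ⟨j, hj⟩ := (hc l).2.1.1 (htop ▸ hl)
    have := mem_of_reachable (d₁ := d₁) (d₂ := d₂)
      ({x | x.1 = 1 ∧ x.2 ∈ C ∨ x.1 = 0 ∧ d₁.top.link x.2 = .inr .prop ∧
        ∃ i ∈ C, d₁.bot.link i = .inr .prop ∧ d₁.bot.propRank i = d₁.top.propRank x.2})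
      ?_ ?_ hj (.inr ⟨rfl, hl, i, hi, hip, hli.symm⟩)
    · simp at this
    · rintro (u | u) (v | v) huv hu
      · have h4 : d₁.top.link u = .inl v := huv
        simp [placeUpper, h4] at hu
      · obtain ⟨-, i', h4, h5, h6⟩ : _ ∧ ∃ i ∈ C, d₁.bot.link i = .inr .prop ∧
          d₁.bot.propRank i = d₁.top.propRank u := by simpa [placeUpper] using hu
        obtain rfl := d₁.bot.propRank_inj h5 huv.2.1 (h6.trans huv.2.2)
        exact .inl ⟨rfl, h4⟩
      · have : u ∈ C := by simpa [placeUpper] using hu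
        exact .inr ⟨rfl, huv.1, u, this, huv.2.1, huv.2.2.symm⟩
      · have : u ∈ C := by simpa [placeUpper] using hu
        exact .inl ⟨rfl, h1 u this v huv⟩
    · rintro (u | u) (v | v) huv hu
      · have : u ∈ C := by simpa [placeLower] using hu
        exact .inl ⟨rfl, h2 u this v huv⟩
      · have : u ∈ C := by simpa [placeLower] using hu
        exact absurd huv.1 (h3 u this)
      · simp [placeLower] at hu
      · simp [placeLower] at hu

/-- The lines that return to the lower edge of `d₂` or to a wall below it are lines of the
composite, so that the composite and `d₂` have the same lower half as soon as no propagating line is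
lost. -/
theorem IsComposite.bot_eq (h : IsComposite d₁ d₂ d₃)
    (hle : d₂.bot.count .prop ≤ d₃.bot.count .prop) : d₃.bot = d₂.bot := by
  have harc (i j : Fin n) (hij : d₂.bot.link i = .inl j) : d₃.bot.link i = .inl j :=
    ((h.2 i).1 j).2 ⟨fun e => d₂.bot.link_ne i (e ▸ hij),
      reachable_lower (u := .inr i) (v := .inr j) hij⟩
  have hwall (i : Fin n) (s : Wall) (hi : d₂.bot.link i = .inr (.wall s)) :
      d₃.bot.link i = .inr (.wall s) :=
    ((h.2 i).2.2 s).2 ⟨_, .inr ⟨.inr i, rfl, hi, rfl⟩⟩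
  have hsub : (Finset.univ.filter fun i => d₃.bot.link i = .inr .prop) ⊆
      Finset.univ.filter fun i => d₂.bot.link i = .inr .prop := by
    intro i
    simp only [Finset.mem_filter, Finset.mem_univ, true_and]
    intro hi
    rcases hl : d₂.bot.link i with j | s | _
    · simp [harc i j hl] at hi
    · simp [hwall i s hl] at hi
    · rfl
  have heq := Finset.eq_of_subset_of_card_le hsub hle
  ext1
  funext i
  rcases hl : d₂.bot.link i with j | s | _
  · exact harc i j hl
  · exact hwall i s hl
  · have : i ∈ Finset.univ.filter fun i => d₂.bot.link i = .inr .prop := by simpa using hl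
    rw [← heq] at this
    simpa using this

end Diagram

/-! ### Criteria for pairings -/

namespace HalfDiagram

variable {k : Type*} [Field k] {n : ℕ}

/-- The line at the vertex `i` of the common edge runs straight through the edge. -/
def Straight (u t : HalfDiagram n) (i : Fin n) : Prop :=
  ∃ τ, u.link i = .inr τ ∧ t.link i = .inr τ ∧ Matches u t i i τ

/-- The scalar of the line that runs through the vertex `i` of `u`, if `i` is not on an arc. -/
def vertexScalar (P : BlobParams k) (u : HalfDiagram n) (i : Fin n) : k :=
  match u.link i with
  | .inl _ => 1
  | .inr τ => throughScalar P u i τ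

theorem vertexScalar_of_arc (P : BlobParams k) {u : HalfDiagram n} {i j : Fin n}
    (h : u.link i = .inl j) : vertexScalar P u i = 1 := by
  rw [vertexScalar, h]

theorem vertexScalar_of_free (P : BlobParams k) {u : HalfDiagram n} {i : Fin n} {τ : Terminus}
    (h : u.link i = .inr τ) : vertexScalar P u i = throughScalar P u i τ := by
  rw [vertexScalar, h]

theorem Straight.lineScalar (P : BlobParams k) {u t : HalfDiagram n} {i : Fin n}
    (h : Straight u t i) {C : Set (Fin n)} (hC : ∀ m, m ∈ C ↔ m = i) :
    LineScalar P u t C (vertexScalar P u i) := by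
  obtain ⟨τ, h1, h2, h3⟩ := h
  rw [vertexScalar_of_free P h1]
  exact .through τ i i ((hC i).2 rfl) ((hC i).2 rfl) h1 h2 (fun m hm _ => (hC m).1 hm)
    (fun m hm _ => (hC m).1 hm) h3

theorem Straight.ne_left {u t : HalfDiagram n} {i : Fin n} (h : Straight u t i) (j : Fin n) :
    u.link i ≠ .inl j ∧ t.link i ≠ .inl j := by
  obtain ⟨τ, h1, h2, -⟩ := h
  simp [h1, h2]

theorem pairsTo_straight (P : BlobParams k) {u t : HalfDiagram n} (h : ∀ i, Straight u t i) :
    PairsTo P u t (∏ i, vertexScalar P u i) := by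
  refine ⟨id, _, ⟨?_, ?_, ?_, ?_, ?_⟩, rfl⟩
  · exact fun i j hij => absurd hij ((h i).ne_left j).1
  · exact fun i j hij => absurd hij ((h i).ne_left j).2
  · exact fun i => .refl
  · exact fun r _ => (h r).lineScalar P fun m => Iff.rfl
  · exact fun r hr => absurd rfl hr

/-- A pair of arcs with the same ends. -/
theorem pairsTo_loop (P : BlobParams k) {u t : HalfDiagram n} {x y : Fin n}
    (hu : u.link x = .inl y) (ht : t.link x = .inl y)
    (h : ∀ i, i ≠ x → i ≠ y → Straight u t i) :
    PairsTo P u t (P.δ * ∏ i, vertexScalar P u i) := by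
  have hxy : x ≠ y := fun e => u.link_ne x (hu.trans (e ▸ rfl))
  have hu' := u.link_symm _ _ hu
  have ht' := t.link_symm _ _ ht
  refine ⟨fun i => if i = y then x else i,
    fun i => (if i = x then P.δ else 1) * vertexScalar P u i, ⟨?_, ?_, ?_, ?_, ?_⟩, ?_⟩
  · intro i j hij
    by_cases h1 : i = x
    · subst h1; grind
    by_cases h2 : i = y
    · subst h2; grind
    exact absurd hij ((h i h1 h2).ne_left j).1
  · intro i j hij
    by_cases h1 : i = x
    · subst h1; grind
    by_cases h2 : i = y
    · subst h2; grind
    exact absurd hij ((h i h1 h2).ne_left j).2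
  · intro i
    by_cases h2 : i = y
    · simp only [if_pos h2]
      exact .single (.inl (h2 ▸ hu'))
    · simp only [if_neg h2]
      exact .refl
  · intro r hr
    by_cases h1 : r = x
    · subst h1
      rw [if_pos rfl, vertexScalar_of_arc P hu, mul_one]
      have hC : ∀ m ∈ {i | (if i = y then r else i) = r}, m = y ∨ m = r := by
        intro m hm
        by_cases hmy : m = y
        · exact .inl hmy
        · exact .inr (by simpa [hmy] using hm)
      refine .loop (fun m hm => ?_) (fun m hm => ?_)
      · rcases hC m hm with rfl | rfl <;> simp [hu, hu']
      · rcases hC m hm with rfl | rfl <;> simp [ht, ht']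
    · have h2 : r ≠ y := by grind
      rw [if_neg h1, one_mul]
      refine (h r h1 h2).lineScalar P fun m => ?_
      simp only [Set.mem_ofPred_eq]
      grind
  · intro r hr
    have h2 : r = y := by grind
    rw [h2, if_neg hxy.symm, one_mul, vertexScalar_of_arc P hu']
  · rw [Finset.prod_mul_distrib, Finset.prod_ite_eq' Finset.univ x, if_pos (Finset.mem_univ x)]

/-- An arc of `u` that closes two neighbouring lines to a wall. -/
theorem pairsTo_cap (P : BlobParams k) {u t : HalfDiagram n} {x y : Fin n} {s : Wall}
    (hu : u.link x = .inl y) (hx : t.link x = .inr (.wall s)) (hy : t.link y = .inr (.wall s))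
    (hxy : t.nearer s y = t.nearer s x + 1) (h : ∀ i, i ≠ x → i ≠ y → Straight u t i) :
    PairsTo P u t (P.wallScalar s (t.nearer s x) * ∏ i, vertexScalar P u i) := by
  have hne : x ≠ y := fun e => u.link_ne x (hu.trans (e ▸ rfl))
  have hu' := u.link_symm _ _ hu
  refine ⟨fun i => if i = y then x else i,
    fun i => (if i = x then P.wallScalar s (t.nearer s x) else 1) * vertexScalar P u i,
    ⟨?_, ?_, ?_, ?_, ?_⟩, ?_⟩
  · intro i j hij
    by_cases h1 : i = x
    · subst h1; grind
    by_cases h2 : i = y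
    · subst h2; grind
    exact absurd hij ((h i h1 h2).ne_left j).1
  · intro i j hij
    by_cases h1 : i = x
    · simp [h1, hx] at hij
    by_cases h2 : i = y
    · simp [h2, hy] at hij
    exact absurd hij ((h i h1 h2).ne_left j).2
  · intro i
    by_cases h2 : i = y
    · simp only [if_pos h2]
      exact .single (.inl (h2 ▸ hu'))
    · simp only [if_neg h2]
      exact .refl
  · intro r hr
    by_cases h1 : r = x
    · subst h1
      rw [if_pos rfl, vertexScalar_of_arc P hu, mul_one]
      have hC : ∀ m ∈ {i | (if i = y then r else i) = r}, m = y ∨ m = r := by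
        intro m hm
        by_cases hmy : m = y
        · exact .inl hmy
        · exact .inr (by simpa [hmy] using hm)
      refine .lower s r y (by simp) (by simp) hx hy (fun m hm _ => (hC m hm).symm)
        (fun m hm => ?_) hxy
      rcases hC m hm with rfl | rfl <;> simp [hu, hu']
    · have h2 : r ≠ y := by grind
      rw [if_neg h1, one_mul]
      refine (h r h1 h2).lineScalar P fun m => ?_
      simp only [Set.mem_ofPred_eq]
      grind
  · intro r hr
    have h2 : r = y := by grind
    rw [h2, if_neg hne.symm, one_mul, vertexScalar_of_arc P hu']
  · rw [Finset.prod_mul_distrib, Finset.prod_ite_eq' Finset.univ x, if_pos (Finset.mem_univ x)]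

/-- An arc of `u` from `x` to `y` and an arc of `t` from `y` to `z`, which straighten to a line that
runs through the edge. -/
theorem pairsTo_zigzag (P : BlobParams k) {u t : HalfDiagram n} {x y z : Fin n} {τ : Terminus}
    (hu : u.link x = .inl y) (ht : t.link y = .inl z) (hz : u.link z = .inr τ)
    (hx : t.link x = .inr τ) (hm : Matches u t z x τ)
    (h : ∀ i, i ≠ x → i ≠ y → i ≠ z → Straight u t i) :
    PairsTo P u t (∏ i, vertexScalar P u i) := by
  have hne : x ≠ y := fun e => u.link_ne x (hu.trans (e ▸ rfl))
  have hne' : y ≠ z := fun e => t.link_ne y (ht.trans (e ▸ rfl))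
  have hu' := u.link_symm _ _ hu
  have ht' := t.link_symm _ _ ht
  have hne'' : x ≠ z := fun e => by simp [← e, hu] at hz
  refine ⟨fun i => if i = x ∨ i = y then z else i, _, ⟨?_, ?_, ?_, ?_, ?_⟩, rfl⟩
  · intro i j hij
    by_cases h1 : i = x
    · subst h1; grind
    by_cases h2 : i = y
    · subst h2; grind
    by_cases h3 : i = z
    · simp [h3, hz] at hij
    exact absurd hij ((h i h1 h2 h3).ne_left j).1
  · intro i j hij
    by_cases h1 : i = x
    · simp [h1, hx] at hij
    by_cases h2 : i = y
    · subst h2; grind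
    by_cases h3 : i = z
    · subst h3; grind
    exact absurd hij ((h i h1 h2 h3).ne_left j).2
  · intro i
    by_cases h1 : i = x
    · simp only [if_pos (Or.inl h1)]
      exact .tail (.single (.inl (h1 ▸ hu))) (.inr ht)
    by_cases h2 : i = y
    · simp only [if_pos (Or.inr h2)]
      exact .single (.inr (h2 ▸ ht))
    · simp only [h1, h2, or_self, if_false]
      exact .refl
  · intro r hr
    have h1 : r ≠ x := by grind
    have h2 : r ≠ y := by grind
    by_cases h3 : r = z
    · subst h3
      rw [vertexScalar_of_free P hz]
      have hC : ∀ m ∈ {i | (if i = x ∨ i = y then r else i) = r}, m = x ∨ m = y ∨ m = r := by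
        intro m hm
        simp only [Set.mem_ofPred_eq] at hm
        grind
      refine .through τ r x (by simp) (by simp) hz hx (fun m hmC hfree => ?_)
        (fun m hmC hfree => ?_) hm
      · rcases hC m hmC with rfl | rfl | rfl
        · simp [hu] at hfree
        · simp [hu'] at hfree
        · rfl
      · rcases hC m hmC with rfl | rfl | rfl
        · rfl
        · simp [ht] at hfree
        · simp [ht'] at hfree
    · refine (h r h1 h2 h3).lineScalar P fun m => ?_
      simp only [Set.mem_ofPred_eq]
      grind
  · intro r hr
    have h1 : r = x ∨ r = y := by grind
    rcases h1 with rfl | rfl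
    · exact vertexScalar_of_arc P hu
    · exact vertexScalar_of_arc P hu'

/-! ### Rows with at most one arc -/

/-- The vertex `i` is the `skip s i`-th vertex which is not one of `s`, `s + 1`. -/
def skip (s i : ℕ) : ℕ := if i ≤ s then i else i - 2

/-- The half diagram with an arc that joins the vertices `s` and `s + 1`, and with `ℓ` lines to the
left wall and `p` propagating lines; if `s + 1` is not a vertex, then there is no arc. -/
def row (n ℓ p s : ℕ) : HalfDiagram n where
  link i :=
    if h : i.val = s ∧ s + 1 < n then .inl ⟨s + 1, h.2⟩
    else if h : i.val = s + 1 then .inl ⟨s, by omega⟩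
    else .inr (letter ℓ p (skip s i))
  link_ne i := by
    split_ifs with h1 h2
    · simp [Fin.ext_iff, ← h1.1]
    · simp [Fin.ext_iff, h2]
    · simp
  link_symm i j := by
    have := i.isLt
    have := j.isLt
    split_ifs <;> simp [Fin.ext_iff] <;> omega
  noncrossing i j m hij hjm := by
    have := m.isLt
    simp only [Fin.lt_def] at hij hjm
    split_ifs <;> simp [Fin.ext_iff] <;> omega
  ordered i j τ τ' hij := by
    simp only [Fin.lt_def] at hij
    have hle : skip s i ≤ skip s j ∨ j.val = s + 1 := by
      rw [skip, skip]; split_ifs <;> omega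
    split_ifs
    all_goals try simp
    rintro rfl rfl
    rcases hle with hle | hle
    · simp only [letter]
      split_ifs <;> simp [Terminus.rank] <;> omega
    · omega

theorem row_link_free {n ℓ p s : ℕ} {i : Fin n} (h1 : i.val = s → n ≤ s + 1) (h2 : i.val ≠ s + 1) :
    (row n ℓ p s).link i = .inr (letter ℓ p (skip s i)) := by
  simp only [row]
  rw [dif_neg (by omega), dif_neg h2]

theorem row_link_fst {n ℓ p s : ℕ} (h : s + 1 < n) :
    (row n ℓ p s).link ⟨s, by omega⟩ = .inl ⟨s + 1, h⟩ := by
  simp [row, h]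

theorem row_link_snd {n ℓ p s : ℕ} (h : s + 1 < n) :
    (row n ℓ p s).link ⟨s + 1, h⟩ = .inl ⟨s, by omega⟩ :=
  (row n ℓ p s).link_symm _ _ (row_link_fst h)

/-- The vertex `i` of a row is not on the arc. -/
def IsFree (n s : ℕ) (i : ℕ) : Prop := (i = s → n ≤ s + 1) ∧ i ≠ s + 1

instance (n s i : ℕ) : Decidable (IsFree n s i) := inferInstanceAs (Decidable (_ ∧ _))

/-- The number of vertices that are not on the arc. -/
def freeCard (n s : ℕ) : ℕ := if n ≤ s + 1 then n else n - 2

theorem row_link_eq_inr_iff {n ℓ p s : ℕ} {i : Fin n} {τ : Terminus} :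
    (row n ℓ p s).link i = .inr τ ↔ IsFree n s i ∧ letter ℓ p (skip s i) = τ := by
  by_cases h : IsFree n s i
  · rw [row_link_free h.1 h.2]
    simp [h]
  · simp only [h, false_and, iff_false]
    rw [IsFree] at h
    simp only [row]
    have := i.isLt
    split_ifs <;> simp
    omega

theorem card_skip {n s q q' : ℕ} (hq : q' ≤ freeCard n s) :
    (Finset.univ.filter fun i : Fin n => IsFree n s i ∧ q ≤ skip s i ∧ skip s i < q').card =
      q' - q := by
  rw [← Nat.card_Ico]
  refine Finset.card_bij (fun i _ => skip s i) ?_ ?_ ?_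
  · intro i hi
    simpa using (Finset.mem_filter.1 hi).2.2
  · intro i hi j hj h
    have hi := (Finset.mem_filter.1 hi).2.1
    have hj := (Finset.mem_filter.1 hj).2.1
    rw [IsFree] at hi hj
    rw [Fin.ext_iff]
    have := i.isLt
    have := j.isLt
    simp only [skip] at h
    split_ifs at h <;> omega
  · intro m hm
    rw [Finset.mem_Ico] at hm
    rw [freeCard] at hq
    by_cases h : m < s ∨ n ≤ s + 1
    · refine ⟨⟨m, by split_ifs at hq <;> omega⟩, Finset.mem_filter.2 ⟨Finset.mem_univ _, ?_⟩, ?_⟩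
      · simp only [IsFree, skip]
        split_ifs at hq ⊢ <;> omega
      · simp only [skip]
        split_ifs at hq ⊢ <;> omega
    · refine ⟨⟨m + 2, by split_ifs at hq <;> omega⟩,
        Finset.mem_filter.2 ⟨Finset.mem_univ _, ?_⟩, ?_⟩
      · simp only [IsFree, skip]
        split_ifs at hq ⊢ <;> omega
      · simp only [skip]
        split_ifs at hq ⊢ <;> omega

theorem skip_lt_freeCard {n s : ℕ} {i : Fin n} (h : IsFree n s i) : skip s i < freeCard n s := by
  have := i.isLt
  rw [IsFree] at h
  rw [skip, freeCard]
  split_ifs <;> omega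

theorem lt_iff_skip_lt {n s : ℕ} {i j : Fin n} (hi : IsFree n s i) (hj : IsFree n s j) :
    i < j ↔ skip s i < skip s j := by
  have := i.isLt
  have := j.isLt
  rw [IsFree] at hi hj
  rw [skip, skip, Fin.lt_def]
  split_ifs <;> omega

theorem letter_eq_left {ℓ p m : ℕ} : letter ℓ p m = .wall .left ↔ m < ℓ := by
  rw [letter]; split_ifs <;> simp [*]

theorem letter_eq_prop {ℓ p m : ℕ} : letter ℓ p m = .prop ↔ ℓ ≤ m ∧ m < ℓ + p := by
  rw [letter]; split_ifs <;> simp <;> omega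

theorem letter_eq_right {ℓ p m : ℕ} : letter ℓ p m = .wall .right ↔ ℓ + p ≤ m := by
  rw [letter]; split_ifs <;> simp <;> omega

theorem row_count_left {n ℓ p s : ℕ} (h : ℓ + p ≤ freeCard n s) :
    (row n ℓ p s).count (.wall .left) = ℓ := by
  have := card_skip (n := n) (s := s) (q := 0) (q' := ℓ) (by omega)
  simp only [Nat.zero_le, true_and, Nat.sub_zero] at this
  simp only [count, row_link_eq_inr_iff, letter_eq_left, this]

theorem row_count_prop {n ℓ p s : ℕ} (h : ℓ + p ≤ freeCard n s) :
    (row n ℓ p s).count .prop = p := by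
  have := card_skip (n := n) (s := s) (q := ℓ) (q' := ℓ + p) h
  rw [Nat.add_sub_cancel_left] at this
  simp only [count, row_link_eq_inr_iff, letter_eq_prop, this]

theorem row_nearer_left {n ℓ p s : ℕ} {i : Fin n}
    (hi : (row n ℓ p s).link i = .inr (.wall .left)) :
    (row n ℓ p s).nearer .left i = skip s i := by
  obtain ⟨hf, hl⟩ := row_link_eq_inr_iff.1 hi
  rw [letter_eq_left] at hl
  refine Eq.trans ?_ (card_skip (n := n) (q := 0) (skip_lt_freeCard hf).le)
  rw [nearer]
  congr 1
  ext j
  simp only [Finset.mem_filter, Finset.mem_univ, true_and, row_link_eq_inr_iff, letter_eq_left]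
  constructor
  · rintro ⟨⟨h1, h2⟩, h3⟩
    exact ⟨h1, Nat.zero_le _, (lt_iff_skip_lt h1 hf).1 h3⟩
  · rintro ⟨h1, h2, h3⟩
    exact ⟨⟨h1, h3.trans hl⟩, (lt_iff_skip_lt h1 hf).2 h3⟩

theorem row_propRank {n ℓ p s : ℕ} {i : Fin n} (hi : (row n ℓ p s).link i = .inr .prop) :
    (row n ℓ p s).propRank i = skip s i - ℓ := by
  obtain ⟨hf, hl⟩ := row_link_eq_inr_iff.1 hi
  rw [letter_eq_prop] at hl
  rw [← card_skip (n := n) (q := ℓ) (skip_lt_freeCard hf).le, propRank]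
  congr 1
  ext j
  simp only [Finset.mem_filter, Finset.mem_univ, true_and, row_link_eq_inr_iff, letter_eq_prop]
  constructor
  · rintro ⟨⟨h1, h2⟩, h3⟩
    exact ⟨h1, h2.1, (lt_iff_skip_lt h1 hf).1 h3⟩
  · rintro ⟨h1, h2, h3⟩
    exact ⟨⟨h1, h2, h3.trans hl.2⟩, (lt_iff_skip_lt h1 hf).2 h3⟩

theorem row_nearer_right {n ℓ p s : ℕ} {i : Fin n}
    (hi : (row n ℓ p s).link i = .inr (.wall .right)) :
    (row n ℓ p s).nearer .right i = freeCard n s - (skip s i + 1) := by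
  obtain ⟨hf, hl⟩ := row_link_eq_inr_iff.1 hi
  rw [letter_eq_right] at hl
  rw [← card_skip (n := n) (q := skip s i + 1) le_rfl, nearer]
  congr 1
  ext j
  simp only [Finset.mem_filter, Finset.mem_univ, true_and, row_link_eq_inr_iff, letter_eq_right]
  constructor
  · rintro ⟨⟨h1, h2⟩, h3⟩
    exact ⟨h1, (lt_iff_skip_lt hf h1).1 h3, skip_lt_freeCard h1⟩
  · rintro ⟨h1, h2, h3⟩
    exact ⟨⟨h1, by omega⟩, (lt_iff_skip_lt hf h1).2 h2⟩

end HalfDiagram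

/-! ### The Gram matrix -/

namespace HalfDiagram

variable {k : Type*} [Field k] {n : ℕ}

/-- A vertex off the arcs of two rows is on a straight line through the common edge if it is the
same propagating line in both, or leads to the same wall in both. Arcs before and after the vertex do not
matter, as they take up two vertices each. -/
theorem straight_row {ℓ ℓ' p s s' : ℕ} {i : Fin n} (hs : s < n) (hs' : s' < n)
    (hi : IsFree n s i) (hi' : IsFree n s' i)
    (h : skip s i + ℓ' = skip s' i + ℓ ∨ skip s i < ℓ ∧ skip s' i < ℓ' ∨
      ℓ + p ≤ skip s i ∧ ℓ' + p ≤ skip s' i) :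
    Straight (row n ℓ p s) (row n ℓ' p s') i := by
  have hlt := i.isLt
  have hpar : skip s i % 2 = skip s' i % 2 := by
    rw [IsFree] at hi hi'
    rw [skip, skip]
    split_ifs <;> omega
  have hcard : freeCard n s % 2 = freeCard n s' % 2 := by
    rw [freeCard, freeCard]
    split_ifs <;> omega
  have hl : letter ℓ p (skip s i) = letter ℓ' p (skip s' i) := by
    rw [letter, letter]
    split_ifs <;> first | rfl | omega
  have h1 := (row_link_eq_inr_iff (ℓ := ℓ) (p := p)).2 ⟨hi, rfl⟩
  have h2 := (row_link_eq_inr_iff (ℓ := ℓ') (p := p)).2 ⟨hi', hl.symm⟩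
  refine ⟨_, h1, h2, ?_⟩
  have hc := skip_lt_freeCard hi
  have hc' := skip_lt_freeCard hi'
  rcases hτ : letter ℓ p (skip s i) with (_ | _) | _
  · rw [hτ] at h1 h2
    rw [Matches, row_nearer_left h1, row_nearer_left h2, Nat.even_iff, Nat.even_iff, hpar]
  · rw [hτ] at h1 h2
    rw [Matches, row_nearer_right h1, row_nearer_right h2, Nat.even_iff, Nat.even_iff]
    omega
  · have hle := letter_eq_prop.1 hτ
    have hle' := letter_eq_prop.1 (hl ▸ hτ)
    rw [hτ] at h1 h2
    rw [Matches, row_propRank h1, row_propRank h2]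
    omega

theorem vertexScalar_row_of_not_isFree (P : BlobParams k) {ℓ p s : ℕ} {i : Fin n}
    (h : ¬ IsFree n s i) : vertexScalar P (row n ℓ p s) i = 1 := by
  rcases hl : (row n ℓ p s).link i with j | τ
  · exact vertexScalar_of_arc P hl
  · exact absurd (row_link_eq_inr_iff.1 hl).1 h

theorem vertexScalar_row_left (P : BlobParams k) {ℓ p s : ℕ} {i : Fin n}
    (h : IsFree n s i) (hi : skip s i < ℓ) :
    vertexScalar P (row n ℓ p s) i = P.wallScalar .left (skip s i + 1) := by
  have hl := (row_link_eq_inr_iff (ℓ := ℓ) (p := p)).2 ⟨h, letter_eq_left.2 hi⟩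
  rw [vertexScalar_of_free P hl, throughScalar, row_nearer_left hl]

theorem vertexScalar_row_prop (P : BlobParams k) {ℓ p s : ℕ} {i : Fin n}
    (h : IsFree n s i) (hi : ℓ ≤ skip s i) (hi' : skip s i < ℓ + p) :
    vertexScalar P (row n ℓ p s) i = 1 := by
  have hl := (row_link_eq_inr_iff (ℓ := ℓ) (p := p)).2 ⟨h, letter_eq_prop.2 ⟨hi, hi'⟩⟩
  rw [vertexScalar_of_free P hl, throughScalar]

theorem vertexScalar_row_right (P : BlobParams k) {ℓ p s : ℕ} {i : Fin n}
    (h : IsFree n s i) (hi : ℓ + p ≤ skip s i) :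
    vertexScalar P (row n ℓ p s) i = P.wallScalar .right (freeCard n s - (skip s i + 1) + 1) := by
  have hl := (row_link_eq_inr_iff (ℓ := ℓ) (p := p)).2 ⟨h, letter_eq_right.2 hi⟩
  rw [vertexScalar_of_free P hl, throughScalar, row_nearer_right hl]

/-- A row with one arc has at most one line to each wall, and each contributes the scalar of a
white loop. -/
theorem prod_vertexScalar_arc (P : BlobParams k) {a b p s : ℕ} (ha : a ≤ 1) (hb : b ≤ 1)
    (hp : 1 ≤ p) (hn : n = p + 2 + a + b) (hs : s + 1 < n) :
    ∏ i, vertexScalar P (row n a p s) i = P.δL ^ a * P.δR ^ b := by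
  have key (i : Fin n) : vertexScalar P (row n a p s) i =
      (if i = ⟨if s = 0 then 2 else 0, by split_ifs <;> omega⟩ then P.δL ^ a else 1) *
      (if i = ⟨if s = n - 2 then n - 3 else n - 1, by split_ifs <;> omega⟩ then P.δR ^ b
        else 1) := by
    have hi := i.isLt
    have hσ : i.val ≤ s ∧ skip s i = i ∨ s < i.val ∧ skip s i = i - 2 := by
      rw [skip]; split_ifs <;> omega
    have hc : freeCard n s = n - 2 := by rw [freeCard, if_neg (by omega)]
    simp only [Fin.ext_iff]
    by_cases hfree : IsFree n s i
    · have hf := hfree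
      rw [IsFree] at hf
      by_cases hl : skip s i < a
      · obtain rfl : a = 1 := by omega
        rw [vertexScalar_row_left P hfree hl, P.wallScalar_of_odd_left (by omega),
          if_pos (by split_ifs <;> omega), if_neg (by split_ifs <;> omega), pow_one, mul_one]
      by_cases hr : a + p ≤ skip s i
      · obtain rfl : b = 1 := by omega
        rw [vertexScalar_row_right P hfree hr, hc, P.wallScalar_of_odd_right (by omega),
          if_neg (by split_ifs <;> omega), if_pos (by split_ifs <;> omega), pow_one, one_mul]
      rw [vertexScalar_row_prop P hfree (by omega) (by omega)]
      rcases (by omega : a = 0 ∨ a = 1) with rfl | rfl <;>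
        rcases (by omega : b = 0 ∨ b = 1) with rfl | rfl <;>
        (try simp only [pow_zero, ite_self, one_mul, mul_one]) <;>
        (repeat rw [if_neg (by split_ifs <;> omega)])
      rw [one_mul]
    · rw [vertexScalar_row_of_not_isFree P hfree]
      rw [IsFree] at hfree
      rw [if_neg (by split_ifs <;> omega), if_neg (by split_ifs <;> omega), one_mul]
  simp only [key, Finset.prod_mul_distrib, Finset.prod_ite_eq', Finset.mem_univ, if_true]

/-- Two further lines to the left wall contribute a white and a black loop. -/
theorem prod_vertexScalar_left (P : BlobParams k) {a b p : ℕ} (ha : a ≤ 1) (hb : b ≤ 1)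
    (hp : 1 ≤ p) (hn : n = p + 2 + a + b) :
    ∏ i, vertexScalar P (row n (a + 2) p (n - 1)) i =
      P.δL ^ a * P.δR ^ b * (P.δL * P.κL) := by
  have key (i : Fin n) : vertexScalar P (row n (a + 2) p (n - 1)) i =
      (if i = ⟨2, by omega⟩ then P.δL ^ a else 1) *
      (if i = ⟨n - 1, by omega⟩ then P.δR ^ b else 1) *
      ((if i = ⟨0, by omega⟩ then P.δL else 1) * (if i = ⟨1, by omega⟩ then P.κL else 1)) := by
    have hi := i.isLt
    have hσ : skip (n - 1) i = i := by rw [skip, if_pos (by omega)]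
    have hc : freeCard n (n - 1) = n := by rw [freeCard, if_pos (by omega)]
    have hfree : IsFree n (n - 1) i := by rw [IsFree]; omega
    simp only [Fin.ext_iff]
    by_cases hl : skip (n - 1) i < a + 2
    · rw [vertexScalar_row_left P hfree hl]
      rcases (by omega : a = 0 ∨ a = 1) with rfl | rfl <;>
        simp only [pow_zero, pow_one, ite_self, one_mul] <;>
        rw [if_neg (by omega : ¬ i.val = n - 1)] <;>
        split_ifs <;>
        first
        | (exfalso; omega)
        | (rw [P.wallScalar_of_odd_left (by omega)]; simp only [one_mul, mul_one])
        | (rw [P.wallScalar_of_even_left (by omega)]; simp only [one_mul, mul_one])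
    by_cases hr : a + 2 + p ≤ skip (n - 1) i
    · rw [vertexScalar_row_right P hfree hr, hc]
      obtain rfl : b = 1 := by omega
      rw [P.wallScalar_of_odd_right (by omega)]
      split_ifs <;> first | (exfalso; omega) | simp
    rw [vertexScalar_row_prop P hfree (by omega) (by omega)]
    rcases (by omega : a = 0 ∨ a = 1) with rfl | rfl <;>
      rcases (by omega : b = 0 ∨ b = 1) with rfl | rfl <;>
      (try simp only [pow_zero, ite_self, one_mul, mul_one]) <;>
      split_ifs <;> first | (exfalso; omega) | simp
  simp only [key, Finset.prod_mul_distrib, Finset.prod_ite_eq', Finset.mem_univ, if_true]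

/-- Two further lines to the right wall contribute a white and a black loop. -/
theorem prod_vertexScalar_right (P : BlobParams k) {a b p : ℕ} (ha : a ≤ 1) (hb : b ≤ 1)
    (hp : 1 ≤ p) (hn : n = p + 2 + a + b) :
    ∏ i, vertexScalar P (row n a p (n - 1)) i =
      P.δL ^ a * P.δR ^ b * (P.δR * P.κR) := by
  have key (i : Fin n) : vertexScalar P (row n a p (n - 1)) i =
      (if i = ⟨0, by omega⟩ then P.δL ^ a else 1) *
      (if i = ⟨n - 3, by omega⟩ then P.δR ^ b else 1) *
      ((if i = ⟨n - 1, by omega⟩ then P.δR else 1) *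
        (if i = ⟨n - 2, by omega⟩ then P.κR else 1)) := by
    have hi := i.isLt
    have hσ : skip (n - 1) i = i := by rw [skip, if_pos (by omega)]
    have hc : freeCard n (n - 1) = n := by rw [freeCard, if_pos (by omega)]
    have hfree : IsFree n (n - 1) i := by rw [IsFree]; omega
    simp only [Fin.ext_iff]
    by_cases hl : skip (n - 1) i < a
    · rw [vertexScalar_row_left P hfree hl]
      obtain rfl : a = 1 := by omega
      rw [P.wallScalar_of_odd_left (by omega)]
      split_ifs <;> first | (exfalso; omega) | simp
    by_cases hr : a + p ≤ skip (n - 1) i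
    · rw [vertexScalar_row_right P hfree hr, hc]
      rcases (by omega : b = 0 ∨ b = 1) with rfl | rfl <;>
        simp only [pow_zero, pow_one, ite_self, mul_one] <;>
        split_ifs <;>
        first
        | (exfalso; omega)
        | (rw [P.wallScalar_of_odd_right (by omega)]; simp only [one_mul, mul_one])
        | (rw [P.wallScalar_of_even_right (by omega)]; simp only [one_mul, mul_one])
    rw [vertexScalar_row_prop P hfree (by omega) (by omega)]
    rcases (by omega : a = 0 ∨ a = 1) with rfl | rfl <;>
      rcases (by omega : b = 0 ∨ b = 1) with rfl | rfl <;>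
      (try simp only [pow_zero, ite_self, one_mul, mul_one]) <;>
      split_ifs <;> first | (exfalso; omega) | simp
  simp only [key, Finset.prod_mul_distrib, Finset.prod_ite_eq', Finset.mem_univ, if_true]

/-- The half diagrams of a cell module with at most one line to each wall besides one pair of
vertices. With index `0`, the pair goes to the left wall, with index `n`, it goes to the right wall,
and with index `j` in between, it is the arc from `j - 1` to `j`. -/
def cellRow (n a p j : ℕ) : HalfDiagram n :=
  if j = 0 then row n (a + 2) p (n - 1) else row n a p (j - 1)

/-- A symmetric matrix with rows and columns `0, …, n` which is that of the Temperley-Lieb algebra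
away from the first and the last row and column; these start with `A, K, L` and end with
`R, M, B`. -/
def blobForm (n : ℕ) (δ A K L B M R : k) (i j : ℕ) : k :=
  if i = j then if i = 0 then A else if i = n then B else δ
  else if i + 1 = j ∨ j + 1 = i then if i = 0 ∨ j = 0 then K else if i = n ∨ j = n then M else 1
  else if i + 2 = j ∨ j + 2 = i then if i = 0 ∨ j = 0 then L else if i = n ∨ j = n then R else 0
  else 0

theorem blobForm_comm (n : ℕ) (δ A K L B M R : k) (i j : ℕ) :
    blobForm n δ A K L B M R i j = blobForm n δ A K L B M R j i := by
  simp only [blobForm]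
  split_ifs <;> first | rfl | omega

/-- The Gram matrix in the basis `cellRow`, up to a common factor. -/
def cellGram (P : BlobParams k) (n a b : ℕ) : ℕ → ℕ → k :=
  blobForm n P.δ (P.δL * P.κL) P.κL (if a = 0 then 0 else P.δL) (P.δR * P.κR) P.κR
    (if b = 0 then 0 else P.δR)

theorem cellGram_comm (P : BlobParams k) (n a b i j : ℕ) :
    cellGram P n a b i j = cellGram P n a b j i :=
  blobForm_comm ..

section pairings

variable (P : BlobParams k) {a b p : ℕ}

theorem pairsTo_left_left (ha : a ≤ 1) (hb : b ≤ 1) (hp : 1 ≤ p) (hn : n = p + 2 + a + b) :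
    PairsTo P (row n (a + 2) p (n - 1)) (row n (a + 2) p (n - 1))
      (P.δL ^ a * P.δR ^ b * (P.δL * P.κL)) := by
  rw [← prod_vertexScalar_left P ha hb hp hn]
  refine pairsTo_straight P fun i => ?_
  have hf : IsFree n (n - 1) i := by rw [IsFree]; omega
  exact straight_row (by omega) (by omega) hf hf (.inl rfl)

theorem pairsTo_right_right (ha : a ≤ 1) (hb : b ≤ 1) (hp : 1 ≤ p) (hn : n = p + 2 + a + b) :
    PairsTo P (row n a p (n - 1)) (row n a p (n - 1))
      (P.δL ^ a * P.δR ^ b * (P.δR * P.κR)) := by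
  rw [← prod_vertexScalar_right P ha hb hp hn]
  refine pairsTo_straight P fun i => ?_
  have hf : IsFree n (n - 1) i := by rw [IsFree]; omega
  exact straight_row (by omega) (by omega) hf hf (.inl rfl)

theorem pairsTo_arc_arc (ha : a ≤ 1) (hb : b ≤ 1) (hp : 1 ≤ p) (hn : n = p + 2 + a + b) {s : ℕ}
    (hs : s + 1 < n) :
    PairsTo P (row n a p s) (row n a p s) (P.δL ^ a * P.δR ^ b * P.δ) := by
  rw [← prod_vertexScalar_arc P ha hb hp hn hs, mul_comm]
  refine pairsTo_loop P (row_link_fst hs) (row_link_fst hs) fun i h1 h2 => ?_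
  rw [ne_eq, Fin.ext_iff] at h1 h2
  have hf : IsFree n s i := ⟨fun h => absurd h h1, h2⟩
  exact straight_row (by omega) (by omega) hf hf (.inl rfl)

/-- Neighbouring arcs straighten to a line, without a further scalar. -/
theorem pairsTo_arc_succ (ha : a ≤ 1) (hb : b ≤ 1) (hp : 1 ≤ p) (hn : n = p + 2 + a + b) {s : ℕ}
    (hs : s + 2 < n) :
    PairsTo P (row n a p s) (row n a p (s + 1)) (P.δL ^ a * P.δR ^ b) := by
  rw [← prod_vertexScalar_arc P ha hb hp hn (by omega : s + 1 < n)]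
  have hz : IsFree n s (s + 2) := by rw [IsFree]; omega
  have hx : IsFree n (s + 1) s := by rw [IsFree]; omega
  have hsz : skip s (s + 2) = s := by rw [skip, if_neg (by omega)]; omega
  have hsx : skip (s + 1) s = s := by rw [skip, if_pos (by omega)]
  have h1 : (row n a p s).link ⟨s + 2, hs⟩ = .inr (letter a p s) :=
    row_link_eq_inr_iff.2 ⟨hz, by rw [hsz]⟩
  have h2 : (row n a p (s + 1)).link ⟨s, by omega⟩ = .inr (letter a p s) :=
    row_link_eq_inr_iff.2 ⟨hx, by rw [hsx]⟩
  refine pairsTo_zigzag P (row_link_fst (by omega)) (row_link_fst hs) h1 h2 ?_ fun i h3 h4 h5 => ?_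
  · rcases hτ : letter a p s with (_ | _) | _ <;> rw [hτ] at h1 h2
    · rw [Matches, row_nearer_left h1, row_nearer_left h2, hsz, hsx]
    · rw [Matches, row_nearer_right h1, row_nearer_right h2, hsz, hsx, freeCard, freeCard,
        if_neg (by omega), if_neg (by omega)]
    · rw [Matches, row_propRank h1, row_propRank h2, hsz, hsx]
  · rw [ne_eq, Fin.ext_iff] at h3 h4 h5
    simp only at h3 h4 h5
    refine straight_row (by omega) (by omega) ?_ ?_ (.inl ?_)
    · rw [IsFree]; omega
    · rw [IsFree]; omega
    · rw [skip, skip]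
      split_ifs <;> omega

/-- An arc at `s ≤ a` caps two neighbouring lines to the left wall. -/
theorem pairsTo_arc_left (ha : a ≤ 1) (hb : b ≤ 1) (hp : 1 ≤ p) (hn : n = p + 2 + a + b) {s : ℕ}
    (hs : s ≤ a) :
    PairsTo P (row n a p s) (row n (a + 2) p (n - 1))
      (P.δL ^ a * P.δR ^ b * P.wallScalar .left s) := by
  rw [← prod_vertexScalar_arc P ha hb hp hn (by omega : s + 1 < n), mul_comm]
  have h (i : Fin n) (hi : i.val < a + 2) :
      (row n (a + 2) p (n - 1)).link i = .inr (.wall .left) ∧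
        (row n (a + 2) p (n - 1)).nearer .left i = i := by
    have hl : (row n (a + 2) p (n - 1)).link i = .inr (.wall .left) := by
      refine row_link_eq_inr_iff.2 ⟨by rw [IsFree]; omega, letter_eq_left.2 ?_⟩
      rw [skip, if_pos (by omega)]; exact hi
    exact ⟨hl, by rw [row_nearer_left hl, skip, if_pos (by omega)]⟩
  have hx := h ⟨s, by omega⟩ (by simp only; omega)
  have hy := h ⟨s + 1, by omega⟩ (by simp only; omega)
  have key := pairsTo_cap P (row_link_fst (ℓ := a) (p := p) (s := s) (by omega)) hx.1 hy.1
    (by rw [hx.2, hy.2]) fun i h1 h2 => ?_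
  · rwa [hx.2] at key
  · rw [ne_eq, Fin.ext_iff] at h1 h2
    simp only at h1 h2
    refine straight_row (by omega) (by omega) ?_ ?_ ?_
    · rw [IsFree]; omega
    · rw [IsFree]; omega
    · rw [skip, skip]
      split_ifs <;> omega

/-- An arc at `n - 2 - m` with `m ≤ b` caps two neighbouring lines to the right wall. -/
theorem pairsTo_arc_right (ha : a ≤ 1) (hb : b ≤ 1) (hp : 1 ≤ p) (hn : n = p + 2 + a + b) {m : ℕ}
    (hm : m ≤ b) :
    PairsTo P (row n a p (n - 2 - m)) (row n a p (n - 1))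
      (P.δL ^ a * P.δR ^ b * P.wallScalar .right m) := by
  rw [← prod_vertexScalar_arc P ha hb hp hn (by omega : n - 2 - m + 1 < n), mul_comm]
  have h (i : Fin n) (hi : a + p ≤ i.val) :
      (row n a p (n - 1)).link i = .inr (.wall .right) ∧
        (row n a p (n - 1)).nearer .right i = n - 1 - i := by
    have hl : (row n a p (n - 1)).link i = .inr (.wall .right) := by
      refine row_link_eq_inr_iff.2 ⟨by rw [IsFree]; omega, letter_eq_right.2 ?_⟩
      rw [skip, if_pos (by omega)]; exact hi
    refine ⟨hl, ?_⟩
    rw [row_nearer_right hl, skip, if_pos (by omega), freeCard, if_pos (by omega)]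
    omega
  have hx := h ⟨n - 2 - m + 1, by omega⟩ (by simp only; omega)
  have hy := h ⟨n - 2 - m, by omega⟩ (by simp only; omega)
  have key := pairsTo_cap P (row_link_snd (ℓ := a) (p := p) (s := n - 2 - m) (by omega)) hx.1 hy.1
    (by rw [hx.2, hy.2]; simp only; omega) fun i h1 h2 => ?_
  · rw [hx.2] at key
    convert key using 3
    simp only
    omega
  · rw [ne_eq, Fin.ext_iff] at h1 h2
    simp only at h1 h2
    refine straight_row (by omega) (by omega) ?_ ?_ ?_
    · rw [IsFree]; omega
    · rw [IsFree]; omega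
    · rw [skip, skip]
      split_ifs <;> omega

/-- The vertex `a` leads to the left wall above and propagates below. -/
theorem blocked_left_of_lt {s : ℕ} (hp : 1 ≤ p) (hn : n = p + 2 + a + b) (hs : a < s)
    (hsn : s < n) : Blocked (row n (a + 2) p (n - 1)) (row n a p s) := by
  have h1 : (row n (a + 2) p (n - 1)).link ⟨a, by omega⟩ = .inr (.wall .left) := by
    refine row_link_eq_inr_iff.2 ⟨by simp only [IsFree]; omega, letter_eq_left.2 ?_⟩
    rw [skip, if_pos (by simp only; omega)]; simp only; omega
  have h2 : (row n a p s).link ⟨a, by omega⟩ = .inr .prop := by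
    refine row_link_eq_inr_iff.2 ⟨by simp only [IsFree]; omega, letter_eq_prop.2 ?_⟩
    rw [skip, if_pos (by simp only; omega)]; simp only; omega
  refine ⟨{⟨a, by omega⟩}, ?_, ?_, .inl ⟨?_, ⟨a, by omega⟩, rfl, h2⟩⟩
  · rintro i rfl j hj
    simp [h1] at hj
  · rintro i rfl j hj
    simp [h2] at hj
  · rintro i rfl
    simp [h1]

/-- One of the ends of the arc at `s` propagates below, while the arc joins both ends above. -/
theorem blocked_arc {s s' : ℕ} (ha : a ≤ 1) (hp : 1 ≤ p) (hs : s + 2 ≤ s') (hsn : s' < n)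
    (h : s < a + p) :
    Blocked (row n a p s) (row n a p s') := by
  have h1 := row_link_fst (n := n) (ℓ := a) (p := p) (s := s) (by omega)
  have h2 := row_link_snd (n := n) (ℓ := a) (p := p) (s := s) (by omega)
  have h3 (i : Fin n) (hi : i.val < s') :
      (row n a p s').link i = .inr (letter a p i) := by
    refine row_link_eq_inr_iff.2 ⟨by simp only [IsFree]; omega, ?_⟩
    rw [skip, if_pos (by omega)]
  refine ⟨{⟨s, by omega⟩, ⟨s + 1, by omega⟩}, ?_, ?_, .inl ⟨?_, ?_⟩⟩
  · rintro i (rfl | rfl) j hj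
    · rw [h1] at hj; cases hj; simp
    · rw [h2] at hj; cases hj; simp
  · rintro i (rfl | rfl) j hj
    · rw [h3 _ (by simp only; omega)] at hj; cases hj
    · rw [h3 _ (by simp only; omega)] at hj; cases hj
  · rintro i (rfl | rfl)
    · simp [h1]
    · simp [h2]
  · by_cases hsa : a ≤ s
    · refine ⟨_, .inl rfl, ?_⟩
      rw [h3 _ (by simp only; omega), letter_eq_prop.2 ⟨hsa, h⟩]
    · refine ⟨_, .inr rfl, ?_⟩
      rw [h3 _ (by simp only; omega), letter_eq_prop.2 (by simp only; omega)]

end pairings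

/-- The pairing of two half diagrams in `cellRow`. -/
theorem cellRow_pairsTo_or_blocked (P : BlobParams k) {a b p i j : ℕ} (ha : a ≤ 1) (hb : b ≤ 1)
    (hp : 1 ≤ p) (hn : n = p + 2 + a + b) (hi : i ≤ n) (hj : j ≤ n) :
    PairsTo P (cellRow n a p i) (cellRow n a p j) (P.δL ^ a * P.δR ^ b * cellGram P n a b i j) ∨
      cellGram P n a b i j = 0 ∧ Blocked (cellRow n a p i) (cellRow n a p j) := by
  wlog hij : i ≤ j generalizing i j
  · rw [cellGram_comm]
    exact (this hj hi (by omega)).imp PairsTo.symm (And.imp_right Blocked.symm)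
  rcases Nat.eq_zero_or_pos i with rfl | hi0
  · rw [cellRow, if_pos rfl, cellRow]
    rcases Nat.eq_zero_or_pos j with rfl | hj0
    · rw [if_pos rfl, cellGram, blobForm, if_pos rfl, if_pos rfl]
      exact .inl (pairsTo_left_left P ha hb hp hn)
    rw [if_neg hj0.ne']
    by_cases hja : j - 1 ≤ a
    · refine .inl ?_
      convert (pairsTo_arc_left P ha hb hp hn hja).symm using 2
      rcases (by omega : j = 1 ∨ j = 2 ∧ a = 1) with rfl | ⟨rfl, rfl⟩
      · simp [cellGram, blobForm, BlobParams.wallScalar]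
      · simp [cellGram, blobForm, BlobParams.wallScalar]
    · refine .inr ⟨?_, blocked_left_of_lt hp hn (by omega) (by omega)⟩
      have key (i : ℕ) (hi : i = 0) : cellGram P n a b i j = 0 := by
        simp only [cellGram, blobForm]
        split_ifs <;> first | rfl | omega
      exact key 0 rfl
  rw [cellRow, if_neg hi0.ne', cellRow, if_neg (by omega)]
  obtain rfl | hij' := hij.eq_or_lt
  · refine .inl ?_
    rw [cellGram, blobForm, if_pos rfl, if_neg hi0.ne']
    split_ifs with hin
    · rw [hin]
      exact pairsTo_right_right P ha hb hp hn
    · exact pairsTo_arc_arc P ha hb hp hn (by omega)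
  by_cases hjn : j = n ∧ n ≤ i + 1 + b
  · obtain ⟨rfl, hib⟩ := hjn
    refine .inl ?_
    have := pairsTo_arc_right P ha hb hp hn (m := j - 1 - i) (by omega)
    rw [(by omega : j - 2 - (j - 1 - i) = i - 1)] at this
    convert this using 2
    rcases (by omega : i + 1 = j ∨ i + 2 = j ∧ b = 1) with rfl | ⟨rfl, rfl⟩
    · simp [cellGram, blobForm, BlobParams.wallScalar, hi0.ne']
    · simp [cellGram, blobForm, BlobParams.wallScalar, hi0.ne']
      intro h
      omega
  by_cases hsucc : i + 1 = j
  · refine .inl ?_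
    have := pairsTo_arc_succ P ha hb hp hn (s := i - 1) (by omega)
    rw [(by omega : i - 1 + 1 = j - 1)] at this
    convert this using 1
    convert mul_one _
    simp only [cellGram, blobForm]
    split_ifs <;> first | rfl | omega
  · refine .inr ⟨?_, blocked_arc ha hp (by omega) (by omega) (by omega)⟩
    simp only [cellGram, blobForm]
    split_ifs <;> first | rfl | omega

end HalfDiagram

/-! ### Determinants of tridiagonal matrices -/

section det

variable {k : Type*} [Field k]

/-- The determinant of the upper left `m × m` corner of an infinite matrix. -/
def cornerDet (f : ℕ → ℕ → k) (m : ℕ) : k :=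
  (Matrix.of fun i j : Fin m => f i j).det

theorem cornerDet_congr {f g : ℕ → ℕ → k} {m : ℕ} (h : ∀ i < m, ∀ j < m, f i j = g i j) :
    cornerDet f m = cornerDet g m := by
  refine congrArg Matrix.det ?_
  ext i j
  exact h i i.isLt j j.isLt

theorem cornerDet_smul (c : k) (f : ℕ → ℕ → k) (m : ℕ) :
    cornerDet (fun i j => c * f i j) m = c ^ m * cornerDet f m := by
  have := Matrix.det_smul (Matrix.of fun i j : Fin m => f i j) c
  rw [Fintype.card_fin] at this
  rw [cornerDet, cornerDet, ← this]
  rfl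

/-- The symmetric tridiagonal matrix with diagonal `D` and off-diagonal `O`. -/
def tridiagonal (D O : ℕ → k) (i j : ℕ) : k :=
  if i = j then D i else if i + 1 = j then O i else if j + 1 = i then O j else 0

theorem tridiagonal_eq_zero (D O : ℕ → k) {i j : ℕ} (h1 : i ≠ j) (h2 : i + 1 ≠ j)
    (h3 : j + 1 ≠ i) : tridiagonal D O i j = 0 := by
  rw [tridiagonal, if_neg h1, if_neg h2, if_neg h3]

/-- The three-term recurrence, by expansion along the last row. -/
theorem cornerDet_tridiagonal (D O : ℕ → k) (m : ℕ) :
    cornerDet (tridiagonal D O) (m + 2) =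
      D (m + 1) * cornerDet (tridiagonal D O) (m + 1) -
        O m ^ 2 * cornerDet (tridiagonal D O) m := by
  have hd : tridiagonal D O (m + 1) (m + 1) = D (m + 1) := by rw [tridiagonal, if_pos rfl]
  have h1 : tridiagonal D O m (m + 1) = O m := by
    rw [tridiagonal, if_neg (by omega), if_pos rfl]
  have h2 : tridiagonal D O (m + 1) m = O m := by
    rw [tridiagonal, if_neg (by omega), if_neg (by omega), if_pos rfl]
  have hminor : ((Matrix.of fun i j : Fin (m + 2) => tridiagonal D O i j).submatrix
      (Fin.last (m + 1)).succAbove (Fin.last m).castSucc.succAbove).det =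
      O m * cornerDet (tridiagonal D O) m := by
    rw [Matrix.det_succ_column _ (Fin.last m), Fin.sum_univ_castSucc, Finset.sum_eq_zero, zero_add]
    · have hsub : (((Matrix.of fun i j : Fin (m + 2) => tridiagonal D O i j).submatrix
          (Fin.last (m + 1)).succAbove (Fin.last m).castSucc.succAbove).submatrix
          (Fin.last m).succAbove (Fin.last m).succAbove).det = cornerDet (tridiagonal D O) m := by
        refine congrArg Matrix.det ?_
        ext i j
        simp [Fin.succAbove, Fin.lt_def]
      rw [hsub]
      simp [h1]
    · intro i _
      have := i.isLt
      rw [Matrix.submatrix_apply, Matrix.of_apply,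
        tridiagonal_eq_zero D O (by simp; omega) (by simp; omega) (by simp; omega), mul_zero,
        zero_mul]
  rw [cornerDet, Matrix.det_succ_row _ (Fin.last (m + 1)), Fin.sum_univ_castSucc,
    Fin.sum_univ_castSucc, Finset.sum_eq_zero, hminor]
  · have hsub : ((Matrix.of fun i j : Fin (m + 2) => tridiagonal D O i j).submatrix
        (Fin.last (m + 1)).succAbove (Fin.last (m + 1)).succAbove).det =
        cornerDet (tridiagonal D O) (m + 1) := by
      refine congrArg Matrix.det ?_
      ext i j
      simp
    rw [hsub]
    simp only [Matrix.of_apply, Fin.val_last, Fin.val_castSucc, hd, h2]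
    rw [Odd.neg_one_pow ⟨m, by ring⟩, Even.neg_one_pow ⟨m + 1, by ring⟩]
    ring
  · intro i _
    have := i.isLt
    rw [Matrix.of_apply, tridiagonal_eq_zero D O (by simp; omega) (by simp; omega)
      (by simp; omega), mul_zero, zero_mul]

theorem cornerDet_add_row (f : ℕ → ℕ → k) {m r r' : ℕ} (hr : r < m) (hr' : r' < m) (h : r ≠ r')
    (c : k) : cornerDet (fun i j => if i = r then f r j + c * f r' j else f i j) m =
      cornerDet f m := by
  refine Eq.trans (congrArg Matrix.det ?_) (Matrix.det_updateRow_add_smul_self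
    (Matrix.of fun i j : Fin m => f i j) (i := ⟨r, hr⟩) (j := ⟨r', hr'⟩) (by simpa using h) c)
  ext i j
  rw [Matrix.updateRow_apply]
  simp [Fin.ext_iff]

theorem cornerDet_transpose (f : ℕ → ℕ → k) (m : ℕ) :
    cornerDet (fun i j => f j i) m = cornerDet f m :=
  Matrix.det_transpose _

theorem cornerDet_add_col (f : ℕ → ℕ → k) {m r r' : ℕ} (hr : r < m) (hr' : r' < m) (h : r ≠ r')
    (c : k) : cornerDet (fun i j => if j = r then f i r + c * f i r' else f i j) m =
      cornerDet f m := by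
  rw [← cornerDet_transpose, ← cornerDet_transpose f]
  exact cornerDet_add_row (fun i j => f j i) hr hr' h c

end det

/-! ### Quantum numbers -/

section qNum

open HalfDiagram

variable {k Λ : Type*} [Field k] [AddCommGroupWithOne Λ] (ψ : AddChar Λ k)

theorem qNum_neg (x : Λ) : qNum ψ (-x) = -qNum ψ x := by
  rw [qNum, qNum, neg_neg, ← neg_div, neg_sub]

theorem qNum_mul_two (hq : ψ 1 ≠ ψ (-1)) (x : Λ) :
    qNum ψ x * qNum ψ 2 = qNum ψ (x + 1) + qNum ψ (x - 1) := by
  have h := sub_ne_zero.2 hq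
  simp only [qNum, ← one_add_one_eq_two, sub_eq_add_neg, neg_add, neg_neg,
    AddChar.map_add_eq_mul] at h ⊢
  field_simp
  ring

theorem qNum_add (hq : ψ 1 ≠ ψ (-1)) (x y : Λ) :
    qNum ψ (y + 1) * qNum ψ x - qNum ψ y * qNum ψ (x - 1) = qNum ψ (x + y) := by
  have h := sub_ne_zero.2 hq
  simp only [qNum, sub_eq_add_neg, neg_add, neg_neg, AddChar.map_add_eq_mul] at h ⊢
  field_simp
  ring

/-- The determinant of a Temperley-Lieb Gram matrix with a blob at either end. -/
theorem cornerDet_blob (hq : ψ 1 ≠ ψ (-1)) (v₁ v₂ : Λ) {n : ℕ} (hn : 2 ≤ n) :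
    cornerDet (tridiagonal
      (fun i => if i = 0 then qNum ψ v₁ * qNum ψ (v₁ + 1) else
        if i = n then qNum ψ v₂ * qNum ψ (v₂ + 1) else qNum ψ 2)
      (fun i => if i = 0 then qNum ψ (v₁ + 1) else if i + 1 = n then qNum ψ (v₂ + 1) else 1))
      (n + 1) =
    -(qNum ψ (v₁ + 1) * qNum ψ (v₂ + 1) * qNum ψ (v₁ + v₂ - n + 2)) := by
  set D : ℕ → k := _
  set O : ℕ → k := _
  change cornerDet (tridiagonal D O) (n + 1) = _
  have hrec := cornerDet_tridiagonal D O
  -- Away from the last row, the corners are those of the Temperley-Lieb algebra with one blob.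
  have key (m : ℕ) (hm : m + 1 < n) :
      cornerDet (tridiagonal D O) (m + 1) = qNum ψ (v₁ + 1) * qNum ψ (v₁ - m) ∧
      cornerDet (tridiagonal D O) (m + 2) = qNum ψ (v₁ + 1) * qNum ψ (v₁ - (m + 1 : ℕ)) := by
    induction m with
    | zero =>
      have h1 : cornerDet (tridiagonal D O) 1 = qNum ψ (v₁ + 1) * qNum ψ v₁ := by
        simp [cornerDet, tridiagonal, D, mul_comm]
      refine ⟨by simpa using h1, ?_⟩
      have hD : D 1 = qNum ψ 2 := by simp only [D]; rw [if_neg (by omega), if_neg (by omega)]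
      have h0 : cornerDet (tridiagonal D O) 0 = 1 := by simp [cornerDet]
      have hO : O 0 = qNum ψ (v₁ + 1) := if_pos rfl
      have := qNum_mul_two ψ hq v₁
      rw [hrec, h1, h0, hD, hO, zero_add, Nat.cast_one]
      linear_combination qNum ψ (v₁ + 1) * this
    | succ m ih =>
      obtain ⟨ih1, ih2⟩ := ih (by omega)
      refine ⟨ih2, ?_⟩
      have hD : D (m + 2) = qNum ψ 2 := by simp only [D]; rw [if_neg (by omega), if_neg (by omega)]
      have hO : O (m + 1) = 1 := by simp only [O]; rw [if_neg (by omega), if_neg (by omega)]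
      have := qNum_mul_two ψ hq (v₁ - (m + 1 : ℕ))
      rw [(by push_cast; abel : v₁ - (m + 1 : ℕ) + 1 = v₁ - m),
        (by push_cast; abel : v₁ - (m + 1 : ℕ) - 1 = v₁ - (m + 1 + 1 : ℕ))] at this
      rw [hrec, ih1, ih2, hD, hO]
      linear_combination qNum ψ (v₁ + 1) * this
  obtain ⟨m, rfl⟩ := Nat.exists_eq_add_of_le' hn
  obtain ⟨h1, h2⟩ := key m (by omega)
  have hD : D (m + 2) = qNum ψ v₂ * qNum ψ (v₂ + 1) := by
    exact (if_neg (by omega)).trans (if_pos rfl)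
  have hO : O (m + 1) = qNum ψ (v₂ + 1) := by
    exact (if_neg (by omega)).trans (if_pos rfl)
  have := qNum_add ψ hq (v₁ - m) v₂
  rw [(by push_cast; abel : v₁ - m - 1 = v₁ - (m + 1 : ℕ)),
    (by push_cast; rw [← one_add_one_eq_two]; abel :
      v₁ - m + v₂ = v₁ + v₂ - (m + 2 : ℕ) + 2)] at this
  rw [hrec, h1, h2, hD, hO]
  linear_combination (-qNum ψ (v₁ + 1) * qNum ψ (v₂ + 1)) * this

/-! ### The determinant of the Gram matrix -/

/-- The exponent `w`, or `-w` if there is an additional line to the wall. -/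
def signedExponent (w : Λ) (a : ℕ) : Λ := if a = 0 then w else -w

theorem qNum_signedExponent {w : Λ} {a : ℕ} : qNum ψ (signedExponent w a) =
    if a = 0 then qNum ψ w else -qNum ψ w := by
  rw [signedExponent]
  split_ifs
  · rfl
  · rw [qNum_neg]

theorem qNum_signedExponent_add_one {w : Λ} {a : ℕ} : qNum ψ (signedExponent w a + 1) =
    if a = 0 then qNum ψ (w + 1) else -qNum ψ (w - 1) := by
  rw [signedExponent]
  split_ifs
  · rfl
  · rw [← qNum_neg, neg_sub, sub_eq_neg_add]

theorem blobForm_congr_left {n : ℕ} {δ A K L B M R A' K' L' : k} {i j : ℕ} (hi : i ≠ 0)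
    (hj : j ≠ 0) : blobForm n δ A K L B M R i j = blobForm n δ A' K' L' B M R i j := by
  simp [blobForm, hi, hj]

/-- Subtracting `L` times the second row and column from the first ones. -/
theorem cornerDet_blobForm_left {n : ℕ} (hn : 4 ≤ n) (δ A K L B M R : k) :
    cornerDet (blobForm n δ A K L B M R) (n + 1) =
      cornerDet (blobForm n δ (A - 2 * L * K + L ^ 2 * δ) (K - L * δ) 0 B M R) (n + 1) := by
  rw [← cornerDet_add_row (blobForm n δ A K L B M R) (r := 0) (r' := 1) (by omega) (by omega)
      (by omega) (-L),
    ← cornerDet_add_col _ (r := 0) (r' := 1) (by omega) (by omega) (by omega) (-L)]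
  have h00 (A K L : k) : blobForm n δ A K L B M R 0 0 = A := by simp [blobForm]
  have h01 (A K L : k) : blobForm n δ A K L B M R 0 1 = K := by simp [blobForm]
  have h11 (A K L : k) : blobForm n δ A K L B M R 1 1 = δ := by
    rw [blobForm, if_pos rfl, if_neg one_ne_zero, if_neg (by omega)]
  have h0 (A K L : k) (j : ℕ) (hj : 2 ≤ j) :
      blobForm n δ A K L B M R 0 j = if j = 2 then L else 0 := by
    have h1 : ¬ (0 = j) := by omega
    have h2 : ¬ (1 = j) := by omega
    simp [blobForm, h1, h2, eq_comm]
  have h1 (A K L : k) (j : ℕ) (hj : 2 ≤ j) :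
      blobForm n δ A K L B M R 1 j = if j = 2 then 1 else 0 := by
    have h1 : ¬ (1 = j) := by omega
    have h2 : ¬ (j = 0) := by omega
    have h3 : ¬ (1 = n) := by omega
    by_cases h4 : j = 2
    · subst h4
      have h6 : ¬ (2 = n) := by omega
      simp [blobForm, h3, h6]
    · have h5 : ¬ (2 = j) := by omega
      simp [blobForm, h1, h2, h3, h4, h5]
      omega
  have key (j : ℕ) (hj : j ≠ 0) : blobForm n δ A K L B M R 0 j - L * blobForm n δ A K L B M R 1 j =
      blobForm n δ (A - 2 * L * K + L ^ 2 * δ) (K - L * δ) 0 B M R 0 j := by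
    rcases (by omega : j = 1 ∨ 2 ≤ j) with rfl | hj
    · rw [h01, h01, h11]
    · rw [h0 _ _ _ _ hj, h0 _ _ _ _ hj, h1 _ _ _ _ hj]
      split_ifs <;> ring
  refine cornerDet_congr fun i hi j hj => ?_
  by_cases hi0 : i = 0 <;> by_cases hj0 : j = 0
  · subst hi0 hj0
    simp only [if_true]
    rw [blobForm_comm _ _ _ _ _ _ _ _ 1 0, h00, h00, h01, h11]
    ring
  · subst hi0
    simp only [if_true, if_neg hj0]
    rw [← key j hj0]
    ring
  · subst hj0
    simp only [if_true, if_neg hi0]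
    rw [blobForm_comm _ _ _ _ _ _ _ _ i 0, blobForm_comm _ _ _ _ _ _ _ _ i 0,
      blobForm_comm _ _ _ _ _ _ _ _ i 1, ← key i hi0]
    ring
  · simp only [if_neg hi0, if_neg hj0]
    exact blobForm_congr_left hi0 hj0

/-- The reversal of the order of rows and columns. -/
theorem cornerDet_reverse (f : ℕ → ℕ → k) (n : ℕ) :
    cornerDet (fun i j => f (n - i) (n - j)) (n + 1) = cornerDet f (n + 1) := by
  rw [cornerDet, cornerDet, ← Matrix.det_submatrix_equiv_self Fin.revPerm]
  congr 1
  ext i j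
  have := i.isLt
  have := j.isLt
  simp only [Matrix.of_apply, Matrix.submatrix_apply, Fin.revPerm_apply, Fin.val_rev]
  congr 1 <;> omega

theorem cornerDet_blobForm_reverse {n : ℕ} (hn : 3 ≤ n) (δ A K L B M R : k) :
    cornerDet (blobForm n δ A K L B M R) (n + 1) =
      cornerDet (blobForm n δ B M R A K L) (n + 1) := by
  rw [← cornerDet_reverse]
  refine cornerDet_congr fun i hi j hj => ?_
  have hij : n - i = n - j ↔ i = j := by omega
  have h1 : n - i + 1 = n - j ∨ n - j + 1 = n - i ↔ i + 1 = j ∨ j + 1 = i := by omega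
  have h2 : n - i + 2 = n - j ∨ n - j + 2 = n - i ↔ i + 2 = j ∨ j + 2 = i := by omega
  have hi0 : n - i = 0 ↔ i = n := by omega
  have hj0 : n - j = 0 ↔ j = n := by omega
  have hin : n - i = n ↔ i = 0 := by omega
  have hjn : n - j = n ↔ j = 0 := by omega
  simp only [blobForm, hij, h1, h2, hi0, hj0, hin, hjn]
  split_ifs <;> first | rfl | omega

theorem cornerDet_blobForm {n : ℕ} (hn : 3 ≤ n) (δ A K L B M R : k) (hL : L = 0 ∨ 4 ≤ n)
    (hR : R = 0 ∨ 4 ≤ n) :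
    cornerDet (blobForm n δ A K L B M R) (n + 1) =
      cornerDet (blobForm n δ (A - 2 * L * K + L ^ 2 * δ) (K - L * δ) 0
        (B - 2 * R * M + R ^ 2 * δ) (M - R * δ) 0) (n + 1) := by
  have key (A K L B M R : k) (hL : L = 0 ∨ 4 ≤ n) :
      cornerDet (blobForm n δ A K L B M R) (n + 1) =
        cornerDet (blobForm n δ (A - 2 * L * K + L ^ 2 * δ) (K - L * δ) 0 B M R) (n + 1) := by
    rcases hL with rfl | hn
    · simp
    · exact cornerDet_blobForm_left hn ..
  rw [key _ _ _ _ _ _ hL, cornerDet_blobForm_reverse hn, key _ _ _ _ _ _ hR,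
    cornerDet_blobForm_reverse hn]

/-- Subtracting multiples of the neighbouring rows and columns from the first and the last ones
brings the Gram matrix into tridiagonal form. An additional line to a wall amounts to a change of
sign of the exponent. -/
theorem cornerDet_cellGram (hq : ψ 1 ≠ ψ (-1)) (w₁ w₂ : Λ) (κLR : k) {n a b p : ℕ} (ha : a ≤ 1)
    (hb : b ≤ 1) (hp : 1 ≤ p) (hn : n = p + 2 + a + b) :
    cornerDet (cellGram (gmpParams ψ w₁ w₂ κLR) n a b) (n + 1) =
      -(qNum ψ (signedExponent w₁ a + 1) * qNum ψ (signedExponent w₂ b + 1) *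
        qNum ψ (signedExponent w₁ a + signedExponent w₂ b - n + 2)) := by
  rw [← cornerDet_blob ψ hq _ _ (by omega : 2 ≤ n)]
  have hend (w : Λ) (c : ℕ) (hc : c ≤ 1) :
      qNum ψ (signedExponent w c) * qNum ψ (signedExponent w c + 1) =
        qNum ψ w * qNum ψ (w + 1) - 2 * (if c = 0 then 0 else qNum ψ w) * qNum ψ (w + 1) +
          (if c = 0 then 0 else qNum ψ w) ^ 2 * qNum ψ 2 ∧
      qNum ψ (signedExponent w c + 1) =
        qNum ψ (w + 1) - (if c = 0 then 0 else qNum ψ w) * qNum ψ 2 := by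
    rw [qNum_signedExponent, qNum_signedExponent_add_one]
    split_ifs
    · constructor <;> ring
    · have := qNum_mul_two ψ hq w
      constructor
      · linear_combination (-qNum ψ w) * this
      · linear_combination this
  obtain ⟨hA, hK⟩ := hend w₁ a ha
  obtain ⟨hB, hM⟩ := hend w₂ b hb
  have hblob (v₁ v₂ : Λ) : cornerDet (blobForm n (qNum ψ 2) (qNum ψ v₁ * qNum ψ (v₁ + 1))
      (qNum ψ (v₁ + 1)) 0 (qNum ψ v₂ * qNum ψ (v₂ + 1)) (qNum ψ (v₂ + 1)) 0) (n + 1) =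
      cornerDet (tridiagonal
        (fun i => if i = 0 then qNum ψ v₁ * qNum ψ (v₁ + 1) else
          if i = n then qNum ψ v₂ * qNum ψ (v₂ + 1) else qNum ψ 2)
        (fun i => if i = 0 then qNum ψ (v₁ + 1) else if i + 1 = n then qNum ψ (v₂ + 1) else 1))
        (n + 1) := by
    refine cornerDet_congr fun i hi j hj => ?_
    simp only [blobForm, tridiagonal, ite_self]
    split_ifs <;> first | rfl | omega
  rw [← hblob, hA, hB, hK, hM]
  refine cornerDet_blobForm (by omega) _ _ _ _ _ _ _ ?_ ?_
  · by_cases h : a = 0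
    · exact .inl (if_pos h)
    · exact .inr (by omega)
  · by_cases h : b = 0
    · exact .inl (if_pos h)
    · exact .inr (by omega)

end qNum

/-! ### The identity diagram -/

namespace Diagram

open HalfDiagram

variable {k : Type*} [Field k] {n : ℕ}

/-- The diagram in which all lines propagate. -/
def identity (n : ℕ) : Diagram n where
  top := row n 0 n n
  bot := row n 0 n n
  prop_eq := rfl
  parity _ := Iff.rfl

theorem row_all_link (i : Fin n) : (row n 0 n n).link i = .inr .prop := by
  have := i.isLt
  refine row_link_eq_inr_iff.2 ⟨by rw [IsFree]; omega, letter_eq_prop.2 ?_⟩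
  rw [skip, if_pos (by omega)]
  omega

theorem row_all_propRank (i : Fin n) : (row n 0 n n).propRank i = i := by
  have := i.isLt
  rw [row_propRank (row_all_link i), skip, if_pos (by omega), Nat.sub_zero]

theorem identity_lineAdj (i : Fin n) : (identity n).lineAdj (.inl i) (.inr i) :=
  ⟨row_all_link i, row_all_link i, rfl⟩

theorem identity_linkAt (u : Fin n ⊕ Fin n) : (identity n).linkAt u = .inr .prop := by
  rcases u with i | i <;> exact row_all_link i

/-- A label for the line through a vertex when the identity is put on `d`. -/
def identityLabel (d : Diagram n) : Fin 3 × Fin n → ℕ ⊕ Fin 3 × Fin n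
  | (0, i) => (d.top.strand i).map id (Prod.mk 0)
  | (1, i) => (d.top.strand i).map id (Prod.mk 0)
  | (2, i) => (d.bot.strand i).map id (Prod.mk 2)

theorem identityLabel_eq_of_reachable {d : Diagram n} {x y : Fin 3 × Fin n}
    (h : (glue (identity n) d).Reachable x y) : identityLabel d x = identityLabel d y := by
  refine eq_of_reachable _ ?_ ?_ h
  · have key (i j : Fin n) (hij : (identity n).lineAdj (.inl i) (.inr j)) : i = j := by
      have h3 : (row n 0 n n).propRank i = (row n 0 n n).propRank j := hij.2.2
      rw [row_all_propRank, row_all_propRank] at h3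
      exact Fin.ext h3
    rintro (i | i) (j | j) hij
    · have h1 : (row n 0 n n).link i = .inl j := hij
      simp [row_all_link] at h1
    · rw [key i j hij]; rfl
    · rw [key j i hij]; rfl
    · have h1 : (row n 0 n n).link i = .inl j := hij
      simp [row_all_link] at h1
  · have key (i j : Fin n) (hij : d.lineAdj (.inl i) (.inr j)) :
        identityLabel d (1, i) = identityLabel d (2, j) := by
      obtain ⟨h1, h2, h3⟩ := hij
      change (d.top.strand i).map id (Prod.mk 0) = (d.bot.strand j).map id (Prod.mk 2)
      rw [(strand_eq_inl_iff _).2 ⟨h1, h3⟩, (strand_eq_inl_iff _).2 ⟨h2, rfl⟩]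
      rfl
    rintro (i | i) (j | j) hij
    · exact congrArg (Sum.map id (Prod.mk 0)) ((strand_eq_iff _).2 (.inr hij))
    · exact key i j hij
    · exact (key j i hij).symm
    · exact congrArg (Sum.map id (Prod.mk 2)) ((strand_eq_iff _).2 (.inr hij))

theorem reachable_identity (d : Diagram n) (i : Fin n) :
    (glue (identity n) d).Reachable (0, i) (1, i) :=
  reachable_upper (u := .inl i) (v := .inr i) (identity_lineAdj i)

theorem map_mk_ne {s s' : ℕ ⊕ Fin n} {i : Fin n} {c c' : Fin 3} (hs : s = .inr i) (hc : c ≠ c') :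
    s.map id (Prod.mk c) ≠ s'.map id (Prod.mk c') := by
  subst hs
  rcases s' with m | j <;> simp [hc]

theorem isComposite_identity (d : Diagram n) : IsComposite (identity n) d d := by
  refine ⟨fun i => ⟨fun j => ?_, ?_, fun s => ?_⟩, fun i => ⟨fun j => ?_, ?_, fun s => ?_⟩⟩
  · constructor
    · intro hl
      exact ⟨fun e => d.top.link_ne i (e ▸ hl), (reachable_identity d i).trans
        ((reachable_lower (u := .inl i) (v := .inl j) hl).trans (reachable_identity d j).symm)⟩
    · rintro ⟨h1, h2⟩
      exact ((strand_eq_iff _).1 (map_mk_injective (identityLabel_eq_of_reachable h2))).resolve_left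
        (Ne.symm h1)
  · constructor
    · intro hl
      obtain ⟨j, h1, h2⟩ := d.bot.exists_propRank_eq (d.prop_eq ▸ d.top.propRank_lt_count hl)
      exact ⟨j, (reachable_identity d i).trans
        (reachable_lower (u := .inl i) (v := .inr j) ⟨hl, h1, h2.symm⟩)⟩
    · rintro ⟨j, hj⟩
      have hj := identityLabel_eq_of_reachable hj
      rcases hs : d.top.strand i with m | r
      · exact ((strand_eq_inl_iff _).1 hs).1
      · exact absurd hj (map_mk_ne hs (by decide))
  · constructor
    · intro hl
      exact ⟨_, .inr ⟨.inl i, SimpleGraph.ConnectedComponent.eq.2 (reachable_identity d i).symm,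
        hl, rfl⟩⟩
    · rintro ⟨p, ⟨u, -, hl, -⟩ | ⟨u, hu, hl, -⟩⟩
      · simp [identity_linkAt] at hl
      · have hu := identityLabel_eq_of_reachable (SimpleGraph.ConnectedComponent.eq.1 hu)
        rcases u with j | j
        · exact eq_of_strand_eq hl (map_mk_injective hu) ▸ hl
        · exact absurd hu (map_mk_ne (strand_of_wall hl) (by decide))
  · constructor
    · intro hl
      exact ⟨fun e => d.bot.link_ne i (e ▸ hl), reachable_lower (u := .inr i) (v := .inr j) hl⟩
    · rintro ⟨h1, h2⟩
      exact ((strand_eq_iff _).1 (map_mk_injective (identityLabel_eq_of_reachable h2))).resolve_left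
        (Ne.symm h1)
  · constructor
    · intro hl
      obtain ⟨j, h1, h2⟩ := d.top.exists_propRank_eq (d.prop_eq ▸ d.bot.propRank_lt_count hl)
      exact ⟨j, ((reachable_identity d j).trans
        (reachable_lower (u := .inl j) (v := .inr i) ⟨h1, hl, h2⟩)).symm⟩
    · rintro ⟨j, hj⟩
      have hj := identityLabel_eq_of_reachable hj
      rcases hs : d.bot.strand i with m | r
      · exact ((strand_eq_inl_iff _).1 hs).1
      · exact absurd hj (map_mk_ne hs (by decide))
  · constructor
    · intro hl
      exact ⟨_, .inr ⟨.inr i, rfl, hl, rfl⟩⟩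
    · rintro ⟨p, ⟨u, -, hl, -⟩ | ⟨u, hu, hl, -⟩⟩
      · simp [identity_linkAt] at hl
      · have hu := identityLabel_eq_of_reachable (SimpleGraph.ConnectedComponent.eq.1 hu)
        rcases u with j | j
        · exact absurd hu (map_mk_ne (strand_of_wall hl) (by decide))
        · exact eq_of_strand_eq hl (map_mk_injective hu) ▸ hl

theorem not_isInner_identity (d : Diagram n) (c : (glue (identity n) d).ConnectedComponent) :
    ¬ IsInner (identity n) d c := by
  intro hc
  obtain ⟨⟨e, i⟩, rfl⟩ := c.exists_rep
  obtain rfl : e = 1 := hc (e, i) rfl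
  exact absurd (hc (0, i) (SimpleGraph.ConnectedComponent.eq.2 (reachable_identity d i)))
    (by simp)

theorem coeff_identity (P : BlobParams k) (d : Diagram n) (hd : d.top.count .prop ≠ 0) :
    coeff P (identity n) d = 1 := by
  have hn : (identity n).top.count .prop ≠ 0 := by
    have h : (row n 0 n n).count .prop = n := row_count_prop (by rw [freeCard, if_pos] <;> omega)
    have h1 := d.top.card_isLeft_add_counts
    change (row n 0 n n).count .prop ≠ 0
    omega
  have hc : crossCount (identity n) d = 0 := by
    rw [crossCount, crossLines_eq_zero _ hn, crossLines_eq_zero _ hd, zero_add, zero_add]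
    exact (Set.ncard_eq_zero (Set.toFinite _)).2
      (Set.eq_empty_iff_forall_notMem.2 fun c h => not_isInner_identity d c h.1)
  rw [coeff, hc, Nat.zero_div, pow_zero, one_mul]
  exact finprod_eq_one_of_forall_eq_one fun c => if_neg (not_isInner_identity d c)

end Diagram

/-! ### Monomial bases of a cell module -/

namespace BlobSpace

open Diagram

variable {k : Type*} [Field k] {n : ℕ}

theorem mulDiagram_identity (P : BlobParams k) (d : Diagram n) (hd : d.top.count .prop ≠ 0) :
    mulDiagram P (identity n) d = Finsupp.single d 1 := by
  rw [mulDiagram_of_isComposite P (isComposite_identity d), coeff_identity P d hd]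

/-- The diagrams that occur in the products `x * d` and do not vanish in the cell module. -/
def cellSupport (P : BlobParams k) (d : Diagram n) : Set (Diagram n) :=
  {c | |d.label| ≤ |c.label| ∧ ∃ x, mulDiagram P x d c ≠ 0}

theorem exists_of_mulDiagram_apply_ne_zero (P : BlobParams k) {x d c : Diagram n}
    (h : mulDiagram P x d c ≠ 0) :
    IsComposite x d c ∧ mulDiagram P x d = Finsupp.single c (mulDiagram P x d c) := by
  by_cases hc : IsComposite x d c
  · refine ⟨hc, ?_⟩
    rw [mulDiagram_of_isComposite P hc, Finsupp.single_eq_same]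
  · exact absurd (mulDiagram_apply_of_not_isComposite P hc) h

theorem mkQ_single_eq_zero {l : ℤ} {c : Diagram n} (h : |c.label| < |l|) (m : k) :
    (lowerIdeal k n l).mkQ (Finsupp.single c m) = 0 := by
  rw [Submodule.mkQ_apply, Submodule.Quotient.mk_eq_zero, ← mul_one m, ← smul_eq_mul,
    ← Finsupp.smul_single]
  exact Submodule.smul_mem _ _ (Submodule.subset_span ⟨c, h, rfl⟩)

/-- The coefficient of a diagram with at least `|l|` lines is well defined modulo lower diagrams. -/
theorem exists_coordinate {l : ℤ} {c : Diagram n} (h : |l| ≤ |c.label|) :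
    ∃ f : (BlobSpace k n ⧸ lowerIdeal k n l) →ₗ[k] k, ∀ x, f ((lowerIdeal k n l).mkQ x) = x c := by
  classical
  refine ⟨(lowerIdeal k n l).liftQ (Finsupp.lapply c) ?_, fun x => ?_⟩
  · refine Submodule.span_le.2 ?_
    rintro _ ⟨c', hc', rfl⟩
    have : c' ≠ c := by rintro rfl; omega
    simp [this]
  · exact Submodule.liftQ_apply ..

theorem cellModule_eq_span (P : BlobParams k) (d : Diagram n) :
    cellModule P d = Submodule.span k
      ((fun c => (lowerIdeal k n d.label).mkQ (Finsupp.single c 1)) '' cellSupport P d) := by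
  have hmul : (mul P).flip (Finsupp.single d 1) =
      Finsupp.linearCombination k fun x => mulDiagram P x d := by
    ext x
    simp [mul]
  rw [cellModule, hmul, Finsupp.range_linearCombination, Submodule.map_span]
  refine le_antisymm (Submodule.span_le.2 ?_) (Submodule.span_le.2 ?_)
  · rintro _ ⟨_, ⟨x, rfl⟩, rfl⟩
    change (lowerIdeal k n d.label).mkQ (mulDiagram P x d) ∈ _
    by_cases h0 : mulDiagram P x d = 0
    · rw [h0, map_zero]
      exact Submodule.zero_mem _
    obtain ⟨c, hc⟩ := Finsupp.ne_iff.1 h0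
    have hx := (exists_of_mulDiagram_apply_ne_zero P hc).2
    by_cases hl : |d.label| ≤ |c.label|
    · rw [hx, ← mul_one (mulDiagram P x d c), ← smul_eq_mul, ← Finsupp.smul_single, map_smul]
      exact Submodule.smul_mem _ _ (Submodule.subset_span ⟨c, ⟨hl, x, hc⟩, rfl⟩)
    · rw [hx, mkQ_single_eq_zero (by omega)]
      exact Submodule.zero_mem _
  · rintro _ ⟨c, ⟨hl, x, hc⟩, rfl⟩
    have hx := (exists_of_mulDiagram_apply_ne_zero P hc).2
    have : Finsupp.single c (1 : k) = (mulDiagram P x d c)⁻¹ • mulDiagram P x d := by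
      conv_rhs => rw [hx]
      rw [Finsupp.smul_single, Finsupp.single_eq_same, smul_eq_mul, inv_mul_cancel₀ hc]
    simp only [this, map_smul]
    exact Submodule.smul_mem _ _ (Submodule.subset_span ⟨_, ⟨x, rfl⟩, rfl⟩)

theorem mem_of_mkQ_single_mem_span {l : ℤ} {c : Diagram n} (h : |l| ≤ |c.label|)
    {S : Set (Diagram n)} (hc : (lowerIdeal k n l).mkQ (Finsupp.single c 1) ∈ Submodule.span k
      ((fun c => (lowerIdeal k n l).mkQ (Finsupp.single c 1)) '' S)) : c ∈ S := by
  classical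
  by_contra hcS
  obtain ⟨f, hf⟩ := exists_coordinate (k := k) h
  have hle : Submodule.span k ((fun c => (lowerIdeal k n l).mkQ (Finsupp.single c 1)) '' S) ≤
      LinearMap.ker f := by
    refine Submodule.span_le.2 ?_
    rintro _ ⟨c', hc', rfl⟩
    have : c' ≠ c := by rintro rfl; exact hcS hc'
    rw [SetLike.mem_coe, LinearMap.mem_ker, hf, Finsupp.single_apply, if_neg this]
  have := LinearMap.mem_ker.1 (hle hc)
  rw [hf, Finsupp.single_eq_same] at this
  exact one_ne_zero this

/-- There is only one monomial basis, since a product with `d` is a multiple of a diagram. -/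
theorem isMonomialBasis_iff (P : BlobParams k) (d : Diagram n) (s : Finset (Diagram n)) :
    IsMonomialBasis P d s ↔ (s : Set (Diagram n)) = cellSupport P d := by
  classical
  have himg : (Set.range fun b : s =>
      (lowerIdeal k n d.label).mkQ (Finsupp.single (b : Diagram n) (1 : k))) =
      (fun c => (lowerIdeal k n d.label).mkQ (Finsupp.single c 1)) '' (s : Set (Diagram n)) := by
    ext x
    simp
  rw [IsMonomialBasis, himg, cellModule_eq_span]
  constructor
  · rintro ⟨hli, hspan⟩
    have hhigh (b : Diagram n) (hb : b ∈ s) : |d.label| ≤ |b.label| := by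
      by_contra hlt
      exact hli.ne_zero ⟨b, hb⟩ (mkQ_single_eq_zero (not_le.1 hlt) 1)
    ext c
    constructor
    · intro hc
      refine mem_of_mkQ_single_mem_span (k := k) (hhigh c hc) ?_
      rw [← hspan]
      exact Submodule.subset_span ⟨c, hc, rfl⟩
    · intro hc
      refine mem_of_mkQ_single_mem_span (k := k) hc.1 ?_
      rw [hspan]
      exact Submodule.subset_span ⟨c, hc, rfl⟩
  · intro hs
    refine ⟨?_, by rw [hs]⟩
    rw [linearIndependent_iff']
    intro t g hg b hb
    obtain ⟨f, hf⟩ := exists_coordinate (k := k) (hs ▸ b.2 : (b : Diagram n) ∈ cellSupport P d).1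
    have := congrArg f hg
    simp only [map_sum, map_smul, hf, map_zero, Finsupp.single_apply, smul_eq_mul, mul_ite, mul_one,
      mul_zero, ← Subtype.ext_iff, Finset.sum_ite_eq', hb, if_true] at this
    exact this

end BlobSpace

/-! ### The classification of the half diagrams -/

namespace HalfDiagram

variable {n : ℕ}

theorem cellRow_count_prop {a b p j : ℕ} (hn : n = p + 2 + a + b) :
    (cellRow n a p j).count .prop = p := by
  rw [cellRow]
  split_ifs
  · exact row_count_prop (by rw [freeCard]; split_ifs <;> omega)
  · exact row_count_prop (by rw [freeCard]; split_ifs <;> omega)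

theorem cellRow_count_left {a b p j : ℕ} (hn : n = p + 2 + a + b) :
    (cellRow n a p j).count (.wall .left) = if j = 0 then a + 2 else a := by
  rw [cellRow]
  split_ifs
  · exact row_count_left (by rw [freeCard]; split_ifs <;> omega)
  · exact row_count_left (by rw [freeCard]; split_ifs <;> omega)

theorem cellRow_injOn {a b p i j : ℕ} (hn : n = p + 2 + a + b) (hi : i ≤ n) (hj : j ≤ n)
    (h : cellRow n a p i = cellRow n a p j) : i = j := by
  have h1 := congrArg (fun x => x.count (.wall .left)) h
  simp only [cellRow_count_left hn] at h1
  by_cases hi0 : i = 0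
  · by_contra
    rw [if_pos hi0, if_neg (by omega)] at h1
    omega
  by_cases hj0 : j = 0
  · rw [if_neg hi0, if_pos hj0] at h1
    omega
  wlog hij : i ≤ j generalizing i j
  · exact (this hj hi h.symm h1.symm hj0 hi0 (by omega)).symm
  by_contra hne
  rw [cellRow, cellRow, if_neg hi0, if_neg hj0] at h
  have h2 := row_link_fst (n := n) (ℓ := a) (p := p) (s := i - 1) (by omega)
  rw [h, row_link_free (by simp only; omega) (by simp only; omega)] at h2
  simp at h2

theorem freeBefore_eq_of_no_arc (x : HalfDiagram n) (h : ∀ i, (x.link i).isRight) (i : Fin n) :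
    x.freeBefore i = i := by
  simp only [freeBefore, h, true_and]
  rw [← Fin.card_Iio i]
  congr 1
  ext j
  simp

theorem freeBefore_eq_skip (x : HalfDiagram n) {s : ℕ} (hs : s + 1 < n)
    (h : ∀ i : Fin n, (x.link i).isRight ↔ i.val ≠ s ∧ i.val ≠ s + 1) {i : Fin n}
    (hi : (x.link i).isRight) : x.freeBefore i = skip s i := by
  have hf : IsFree n s i := ⟨fun e => absurd e ((h i).1 hi).1, ((h i).1 hi).2⟩
  refine Eq.trans ?_ (card_skip (n := n) (q := 0) (skip_lt_freeCard hf).le)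
  rw [freeBefore]
  congr 1
  ext j
  simp only [Finset.mem_filter, Finset.mem_univ, true_and, h]
  constructor
  · rintro ⟨h1, h2⟩
    have hj : IsFree n s j := ⟨fun e => absurd e h1.1, h1.2⟩
    exact ⟨hj, Nat.zero_le _, (lt_iff_skip_lt hj hf).1 h2⟩
  · rintro ⟨h1, -, h2⟩
    exact ⟨⟨fun e => by have := h1.1 e; omega, h1.2⟩, (lt_iff_skip_lt h1 hf).2 h2⟩

/-- A half diagram without arcs is determined by the numbers of lines to the walls. -/
theorem eq_row_of_no_arc (x : HalfDiagram n) (h : ∀ i, (x.link i).isRight) :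
    x = row n (x.count (.wall .left)) (x.count .prop) (n - 1) := by
  ext1
  funext i
  have := i.isLt
  rw [x.link_eq_letter (h i), x.freeBefore_eq_of_no_arc h]
  refine (row_link_eq_inr_iff.2 ⟨by rw [IsFree]; omega, ?_⟩).symm
  rw [skip, if_pos (by omega)]

/-- An arc that is the only one joins neighbouring vertices. -/
theorem exists_eq_row_of_arc (x : HalfDiagram n)
    (h : (Finset.univ.filter fun i => (x.link i).isLeft).card = 2) :
    ∃ s, s + 1 < n ∧ x = row n (x.count (.wall .left)) (x.count .prop) s := by
  obtain ⟨i, j, hij, hl, hset⟩ : ∃ i j : Fin n, i < j ∧ x.link i = .inl j ∧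
      ∀ m, (x.link m).isLeft → m = i ∨ m = j := by
    obtain ⟨i, j, hne, hset⟩ := Finset.card_eq_two.1 h
    have hmem (m : Fin n) : (x.link m).isLeft ↔ m = i ∨ m = j := by
      have := Finset.ext_iff.1 hset m
      simpa using this
    obtain ⟨j', hj'⟩ := Sum.isLeft_iff.1 ((hmem i).2 (.inl rfl))
    have hj := x.link_symm i j' hj'
    obtain rfl : j' = j := ((hmem j').1 (by simp [hj])).resolve_left
      fun e => x.link_ne i (e ▸ hj')
    rcases lt_or_gt_of_ne hne with hlt | hlt
    · exact ⟨i, j', hlt, hj', fun m hm => (hmem m).1 hm⟩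
    · exact ⟨j', i, hlt, hj, fun m hm => ((hmem m).1 hm).symm⟩
  have hsucc : j.val = i.val + 1 := by
    by_contra hne
    have hlt : i.val < j.val := hij
    have hjn := j.isLt
    obtain ⟨j', hj', h1, h2⟩ := x.noncrossing i ⟨i + 1, by omega⟩ j (by simp [Fin.lt_def])
      (by rw [Fin.lt_def]; simp only; omega) hl
    rcases hset ⟨i + 1, by omega⟩ (by simp [hj']) with e | e <;> rw [Fin.ext_iff] at e <;>
      simp only at e <;> omega
  have hl' := x.link_symm i j hl
  have hs : i.val + 1 < n := hsucc ▸ j.isLt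
  refine ⟨i, hs, ?_⟩
  have hfree (m : Fin n) : (x.link m).isRight ↔ m.val ≠ i.val ∧ m.val ≠ i.val + 1 := by
    constructor
    · intro hm
      constructor
      · intro e
        rw [Fin.ext e, hl] at hm
        simp at hm
      · intro e
        rw [(Fin.ext (e.trans hsucc.symm) : m = j), hl'] at hm
        simp at hm
    · rintro ⟨h1, h2⟩
      by_contra hm
      rcases hset m (by simpa using hm) with e | e
      · exact h1 (congrArg Fin.val e)
      · exact h2 ((congrArg Fin.val e).trans hsucc)
  ext1
  funext m
  by_cases hm : (x.link m).isRight
  · rw [x.link_eq_letter hm, x.freeBefore_eq_skip hs hfree hm]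
    refine (row_link_eq_inr_iff.2 ⟨⟨fun e => absurd e ((hfree m).1 hm).1, ((hfree m).1 hm).2⟩,
      rfl⟩).symm
  · rcases hset m (by simpa using hm) with rfl | rfl
    · rw [hl, (Fin.ext hsucc : j = ⟨m + 1, hs⟩)]
      exact (row_link_fst hs).symm
    · rw [hl', (Fin.ext hsucc : m = ⟨i + 1, hs⟩)]
      exact (row_link_snd hs).symm

/-- The half diagrams with the given number of propagating lines and the given colour are those in
`cellRow`. -/
theorem exists_eq_cellRow {a b p : ℕ} (ha : a ≤ 1) (hb : b ≤ 1) (hn : n = p + 2 + a + b)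
    (x : HalfDiagram n) (hx : x.count .prop = p) (hpar : Even (x.count (.wall .left)) ↔ a = 0) :
    ∃ j ≤ n, x = cellRow n a p j := by
  have h1 := x.card_isLeft_add_counts
  have h2 := x.even_card_isLeft
  rw [Nat.even_iff] at h2 hpar
  rcases Nat.eq_zero_or_pos (Finset.univ.filter fun i => (x.link i).isLeft).card with h0 | h0
  · have hfree (i : Fin n) : (x.link i).isRight := by
      have := Finset.filter_eq_empty_iff.1 (Finset.card_eq_zero.1 h0) (Finset.mem_univ i)
      simpa using this
    have hrow := x.eq_row_of_no_arc hfree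
    rw [hx] at hrow
    rcases (by omega : x.count (.wall .left) = a ∨ x.count (.wall .left) = a + 2) with hl | hl
    · exact ⟨n, le_rfl, by rwa [cellRow, if_neg (by omega), ← hl]⟩
    · exact ⟨0, Nat.zero_le _, by rwa [cellRow, if_pos rfl, ← hl]⟩
  · obtain ⟨s, hs, hrow⟩ := x.exists_eq_row_of_arc (by omega)
    rw [hx, (by omega : x.count (.wall .left) = a)] at hrow
    exact ⟨s + 1, hs.le, by rwa [cellRow, if_neg (by omega), Nat.add_sub_cancel]⟩

end HalfDiagram

namespace Diagram

variable {n : ℕ}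

theorem abs_label (d : Diagram n) : |d.label| = d.top.count .prop := by
  rw [label, HalfDiagram.label]
  split_ifs <;> simp

end Diagram

namespace HalfDiagram

variable {n : ℕ}

/-- The label determines the number of propagating lines and the colour as long as `p ≠ 0`. -/
theorem label_eq_iff (x : HalfDiagram n) {a p : ℕ} (hp : 1 ≤ p) :
    x.label = (if a = 0 then -(p : ℤ) else p) ↔
      x.count .prop = p ∧ (Even (x.count (.wall .left)) ↔ a = 0) := by
  rw [label]
  by_cases h1 : Even (x.count (.wall .left)) <;> by_cases h2 : a = 0 <;>
    simp only [h1, h2, if_true, if_false, iff_true, iff_false, not_true_eq_false, and_true,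
      and_false, iff_self] <;> omega

end HalfDiagram

/-! ### The Gram determinant of a cell module -/

namespace BlobSpace

open Diagram HalfDiagram

variable {k : Type*} [Field k] {n : ℕ}

/-- The Gram determinant of a cell module with at most one line to each wall besides one pair of
vertices. -/
theorem isGramDetUpToSign_of_cellGram (P : BlobParams k) {a b p : ℕ} (ha : a ≤ 1) (hb : b ≤ 1)
    (hp : 1 ≤ p) (hn : n = p + 2 + a + b) {D : k}
    (hD : (P.δL ^ a * P.δR ^ b) ^ (n + 1) * cornerDet (cellGram P n a b) (n + 1) = D ∨
      (P.δL ^ a * P.δR ^ b) ^ (n + 1) * cornerDet (cellGram P n a b) (n + 1) = -D) :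
    IsGramDetUpToSign P n (if a = 0 then -(p : ℤ) else p) D := by
  classical
  have hrow (j : ℕ) : (cellRow n a p j).count .prop = p ∧
      (Even ((cellRow n a p j).count (.wall .left)) ↔ a = 0) := by
    refine ⟨cellRow_count_prop hn, ?_⟩
    rw [cellRow_count_left hn, Nat.even_iff]
    split_ifs <;> omega
  refine ⟨⟨⟨cellRow n a p 0, cellRow n a p 0, rfl, fun _ => Iff.rfl⟩,
    (label_eq_iff _ hp).2 (hrow 0)⟩, fun d hd => ?_⟩
  obtain ⟨hdp, hdl⟩ := (label_eq_iff _ hp).1 hd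
  have hdp0 : d.top.count .prop ≠ 0 := by omega
  have hbp : d.bot.count .prop = p := d.prop_eq ▸ hdp
  have hbl : Even (d.bot.count (.wall .left)) ↔ a = 0 := (d.parity hdp0).symm.trans hdl
  have hex (j : Fin (n + 1)) : ∃ c : Diagram n, c.top = cellRow n a p j ∧ c.bot = d.bot := by
    have := hrow j
    exact ⟨⟨cellRow n a p j, d.bot, by omega, fun _ => by rw [this.2, hbl]⟩, rfl, rfl⟩
  choose E hEt hEb using hex
  have hEinj : Function.Injective E := fun i j h =>
    Fin.ext (cellRow_injOn hn (by omega) (by omega) (by rw [← hEt, ← hEt, h]))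
  have hEp (j : Fin (n + 1)) : (E j).top.count .prop = p := by
    rw [hEt]; exact (hrow j).1
  have hall (c : Diagram n) (hcb : c.bot = d.bot) (hcp : c.top.count .prop = p) :
      ∃ j, c = E j := by
    have hpar := (c.parity (by omega)).trans (hcb ▸ hbl)
    obtain ⟨j, hj, hc⟩ := exists_eq_cellRow ha hb hn c.top hcp hpar
    exact ⟨⟨j, by omega⟩, Diagram.ext (hc.trans (hEt ⟨j, by omega⟩).symm)
      (hcb.trans (hEb ⟨j, by omega⟩).symm)⟩
  -- The Gram matrix of all diagrams with the lower half of `d`.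
  set G : ℕ → ℕ → k := fun i j => P.δL ^ a * P.δR ^ b * cellGram P n a b i j
  have hdet : cornerDet G (n + 1) = D ∨ cornerDet G (n + 1) = -D := by
    rwa [cornerDet_smul]
  have hpair (i j : Fin (n + 1)) :=
    cellRow_pairsTo_or_blocked P ha hb hp hn (i := i) (j := j) (by omega) (by omega)
  have hgram (i j : Fin (n + 1)) : gram P d (E i) (E j) = G i j := by
    rcases hpair i j with h | ⟨h0, h⟩
    · rw [gram, mulDiagram_of_pairsTo (d₃ := d.doubleBot) (w := G i j), Finsupp.single_eq_same]
      · change PairsTo P (E i).top (E j).top _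
        rwa [hEt, hEt]
      · exact (hEb i).symm
      · exact (hEb j).symm
      · change d.bot.count .prop ≠ 0
        omega
    · rw [gram, mulDiagram_apply_of_not_isComposite]
      · simp only [G, h0, mul_zero]
      · refine not_isComposite_of_blocked ?_ (hEb i).symm (hEb j).symm
        change Blocked (E i).top (E j).top
        rwa [hEt, hEt]
  have hsub (c : Diagram n) (hc : c ∈ cellSupport P d) : ∃ j, c = E j := by
    obtain ⟨hl, x, hx⟩ := hc
    have hcomp := (exists_of_mulDiagram_apply_ne_zero P hx).1
    rw [abs_label, abs_label] at hl
    have hcb := hcomp.bot_eq (by rw [← d.prop_eq, ← c.prop_eq]; omega)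
    exact hall c hcb (by rw [c.prop_eq, hcb, hbp])
  have hd_mem : d ∈ cellSupport P d := by
    -- The product with the identity shows that `d` survives, whatever the parameters.
    refine ⟨le_rfl, identity n, ?_⟩
    rw [mulDiagram_identity P d hdp0, Finsupp.single_eq_same]
    exact one_ne_zero
  obtain ⟨j₀, hj₀⟩ := hall d rfl hdp
  have hfin : (cellSupport P d).Finite :=
    (Set.finite_range E).subset fun c hc => (hsub c hc).imp fun _ h => h.symm
  refine ⟨⟨hfin.toFinset, (isMonomialBasis_iff P d _).2 (hfin.coe_toFinset)⟩, fun s hs => ?_⟩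
  rw [isMonomialBasis_iff] at hs
  have hmem (c : Diagram n) : c ∈ s ↔ c ∈ cellSupport P d := by rw [← hs]; rfl
  suffices h : gramDet P d s = cornerDet G (n + 1) by rwa [h]
  by_cases hcol : ∃ i : Fin (n + 1), G i j₀ ≠ 0
  · -- A diagram that pairs with `d` generates the whole module from `d`.
    obtain ⟨i, hi⟩ := hcol
    have hE (m : Fin (n + 1)) : E m ∈ s := by
      refine (hmem _).2 ⟨by rw [abs_label, abs_label, hEp, hdp], ?_⟩
      refine ⟨⟨(E m).top, (E i).top, by rw [hEp, hEp], fun _ => ?_⟩, ?_⟩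
      · rw [hEt, hEt, (hrow m).2, (hrow i).2]
      · rw [mulDiagram_of_pairsTo (d₃ := E m) (w := G i j₀), Finsupp.single_eq_same]
        · exact hi
        · change PairsTo P (E i).top d.top _
          rw [hj₀, hEt, hEt]
          refine (hpair i j₀).resolve_right fun h => hi ?_
          simp only [G, h.1, mul_zero]
        · rfl
        · exact hEb m
        · rw [hEp]; omega
    let e : Fin (n + 1) ≃ s := Equiv.ofBijective (fun m => ⟨E m, hE m⟩)
      ⟨fun i j h => hEinj (congrArg Subtype.val h),
        fun c => (hsub c ((hmem c).1 c.2)).imp fun _ h => Subtype.ext h.symm⟩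
    rw [gramDet, cornerDet, ← Matrix.det_submatrix_equiv_self e]
    congr 1
    ext i j
    exact hgram i j
  · -- Otherwise `d` is orthogonal to all basis elements, and both determinants have a zero column.
    push Not at hcol
    rw [gramDet, cornerDet, Matrix.det_eq_zero_of_column_eq_zero j₀ hcol,
      Matrix.det_eq_zero_of_column_eq_zero ⟨d, (hmem d).2 hd_mem⟩]
    rintro ⟨c, hc⟩
    obtain ⟨i, rfl⟩ := hsub c ((hmem c).1 hc)
    have := hgram i j₀
    rw [← hj₀, hcol] at this
    exact this

end BlobSpace

theorem proposition6p2p1 {k Λ : Type*} [Field k] [AddCommGroupWithOne Λ] (ψ : AddChar Λ k)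
    (hq : ψ 1 ≠ ψ (-1)) (w₁ w₂ : Λ) (κLR : k) (n : ℕ) :
    (3 ≤ n → BlobSpace.IsGramDetUpToSign (gmpParams ψ w₁ w₂ κLR) n (-((n : ℤ) - 2))
      (qNum ψ (w₁ + 1) * qNum ψ (w₂ + 1) * qNum ψ (w₁ + w₂ - n + 2))) ∧
    (4 ≤ n → BlobSpace.IsGramDetUpToSign (gmpParams ψ w₁ w₂ κLR) n (-((n : ℤ) - 3))
      (qNum ψ w₂ ^ (n + 1) * qNum ψ (w₂ - 1) * qNum ψ (w₁ + 1) * qNum ψ (-w₁ + w₂ + n - 2))) ∧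
    (4 ≤ n → BlobSpace.IsGramDetUpToSign (gmpParams ψ w₁ w₂ κLR) n ((n : ℤ) - 3)
      (qNum ψ w₁ ^ (n + 1) * qNum ψ (w₁ - 1) * qNum ψ (w₂ + 1) * qNum ψ (w₁ - w₂ + n - 2))) ∧
    (5 ≤ n → BlobSpace.IsGramDetUpToSign (gmpParams ψ w₁ w₂ κLR) n ((n : ℤ) - 4)
      (qNum ψ w₁ ^ (n + 1) * qNum ψ w₂ ^ (n + 1) * qNum ψ (w₁ - 1) * qNum ψ (w₂ - 1) *
        qNum ψ (w₁ + w₂ + n - 2))) := by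
  have key (a b p : ℕ) (ha : a ≤ 1) (hb : b ≤ 1) (hp : 1 ≤ p) (hn : n = p + 2 + a + b) (D : k)
      (hD : (qNum ψ w₁ ^ a * qNum ψ w₂ ^ b) ^ (n + 1) *
          (qNum ψ (signedExponent w₁ a + 1) * qNum ψ (signedExponent w₂ b + 1) *
            qNum ψ (signedExponent w₁ a + signedExponent w₂ b - n + 2)) = D ∨
        (qNum ψ w₁ ^ a * qNum ψ w₂ ^ b) ^ (n + 1) *
          (qNum ψ (signedExponent w₁ a + 1) * qNum ψ (signedExponent w₂ b + 1) *
            qNum ψ (signedExponent w₁ a + signedExponent w₂ b - n + 2)) = -D) :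
      BlobSpace.IsGramDetUpToSign (gmpParams ψ w₁ w₂ κLR) n
        (if a = 0 then -(p : ℤ) else p) D := by
    refine BlobSpace.isGramDetUpToSign_of_cellGram _ ha hb hp hn ?_
    rw [cornerDet_cellGram ψ hq w₁ w₂ κLR ha hb hp hn, mul_neg, neg_inj]
    exact hD.symm.imp (fun h => neg_eq_iff_eq_neg.2 h) id
  have h0 (w : Λ) : signedExponent w 0 = w := if_pos rfl
  have h1 (w : Λ) : signedExponent w 1 = -w := if_neg one_ne_zero
  have hs (w : Λ) : qNum ψ (-w + 1) = -qNum ψ (w - 1) := by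
    rw [← qNum_neg, neg_sub, sub_eq_neg_add, add_comm]
  refine ⟨fun hn => ?_, fun hn => ?_, fun hn => ?_, fun hn => ?_⟩
  · convert key 0 0 (n - 2) (by omega) (by omega) (by omega) (by omega) _ (.inl rfl) using 1
    · rw [if_pos rfl]; push_cast [(by omega : 2 ≤ n)]; rfl
    · simp [h0]
  · convert key 0 1 (n - 3) (by omega) (by omega) (by omega) (by omega) _ (.inl rfl) using 1
    · rw [if_pos rfl]; push_cast [(by omega : 3 ≤ n)]; rfl
    · have : qNum ψ (w₁ + -w₂ - n + 2) = -qNum ψ (-w₁ + w₂ + n - 2) := by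
        rw [← qNum_neg]; congr 1; abel
      rw [h0, h1, hs, this, pow_zero, pow_one, one_mul]
      ring
  · convert key 1 0 (n - 3) (by omega) (by omega) (by omega) (by omega) _ (.inl rfl) using 1
    · rw [if_neg one_ne_zero]; push_cast [(by omega : 3 ≤ n)]; rfl
    · have : qNum ψ (-w₁ + w₂ - n + 2) = -qNum ψ (w₁ - w₂ + n - 2) := by
        rw [← qNum_neg]; congr 1; abel
      rw [h0, h1, hs, this, pow_zero, pow_one, mul_one]
      ring
  -- Here there are three changes of sign, so that the opposite sign results.
  · refine (?_ : (n : ℤ) - 4 = _) ▸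
      key 1 1 (n - 4) (by omega) (by omega) (by omega) (by omega) _ (.inr ?_)
    · rw [if_neg one_ne_zero]; push_cast [(by omega : 4 ≤ n)]; rfl
    · have : qNum ψ (-w₁ + -w₂ - n + 2) = -qNum ψ (w₁ + w₂ + n - 2) := by
        rw [← qNum_neg]; congr 1; abel
      rw [h1, h1, hs, hs, this, pow_one, pow_one]
      ring
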